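/- A link projection $L$ is a regular projection of a link to the sphere $S^2$: the image of a finite, nonempty disjoint union of circles under a continuous map to $S^2$ such that every point of the image is either passed exactly once, the image being a (locally flat) arc near it, or is a double point, passed exactly twice, at which two arcs intersect transversely (in suitable local coordinates of $S^2$ the two arcs are the two coordinate axes). The double points are called the crossings of $L$, and the connected components of $S^2 \setminus L$ are called the regions of $L$. The projection $L$ is connected if it is not a split sum, i.e. if it is not the union of two nonempty link projections (each formed by some of its components) that do not meet. A crossing is reducible if there are exactly three regions that have it on their boundary, and $L$ is irreducible if it has no reducible crossing. Two regions are disconnected if no crossing lies on the boundaries of both. A set of regions is isolated if any two distinct regions in it are disconnected, and the isolate-region number $I(L)$ is the maximum cardinality of an isolated set of regions of $L$. **Corollary.** Every connected irreducible link projection $L$ with at least $13$ crossings satisfies $I(L) \geq 3$. -/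

import Mathlib

open Set Topology

namespace LinkProj

/-- The sphere `S²`. -/
abbrev S2 : Type := Metric.sphere (0 : EuclideanSpace ℝ (Fin 3)) 1

/-- `p` is a simple (regular) point of the family of curves `γ`: it is passed exactly once, and near
`p` the image of `γ` is a (locally flat) arc, i.e. in a suitable local coordinate system of `S²`
centred at `p` it is the horizontal coordinate axis. -/
def IsSimplePoint {X : Type*} (γ : X → S2) (p : S2) : Prop :=
  (∃! z, γ z = p) ∧
  ∃ e : OpenPartialHomeomorph S2 (ℝ × ℝ), p ∈ e.source ∧ e p = 0 ∧
    ∀ q ∈ e.source, q ∈ range γ ↔ (e q).2 = 0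

/-- `p` is a transverse double point of the family of curves `γ`: it is passed exactly twice, at two
different parameters `s` and `t`, and in a suitable local coordinate system of `S²` centred at `p`
the image of `γ` is the union of the two coordinate axes, where the branch of `γ` through `s` runs
in the horizontal axis and the branch through `t` runs in the vertical axis. -/
def IsTransverseDoublePoint {X : Type*} [TopologicalSpace X] (γ : X → S2) (p : S2) : Prop :=
  ∃ s t : X, s ≠ t ∧ γ ⁻¹' {p} = {s, t} ∧
  ∃ e : OpenPartialHomeomorph S2 (ℝ × ℝ), p ∈ e.source ∧ e p = 0 ∧
    (∀ q ∈ e.source, q ∈ range γ ↔ (e q).1 = 0 ∨ (e q).2 = 0) ∧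
    (∀ᶠ z in 𝓝 s, (e (γ z)).2 = 0) ∧ (∀ᶠ z in 𝓝 t, (e (γ z)).1 = 0)

/-- A link projection: a regular projection to `S²` of a link with finitely many (and at least one)
components, that is, a continuous family of closed curves on `S²` all of whose multiple points are
double points where two arcs intersect transversely. Smooth and polygonal generic curves are both
included, since their points have local coordinates as above. -/
structure LinkProjection where
  /-- the number of components -/
  components : ℕ
  components_pos : 0 < components
  /-- the parametrization of the projection by a disjoint union of circles -/
  curve : Fin components × Circle → S2
  continuous_curve : Continuous curve
  regular : ∀ p ∈ range curve, IsSimplePoint curve p ∨ IsTransverseDoublePoint curve p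

namespace LinkProjection

variable (L : LinkProjection)

/-- The underlying subset of the sphere. -/
def image : Set S2 := range L.curve

/-- The crossings: the points of the sphere that are passed more than once. -/
def crossings : Set S2 := {p | ∃ s t, s ≠ t ∧ L.curve s = p ∧ L.curve t = p}

/-- The regions: the connected components of the complement of the projection in `S²`. -/
def regions : Set (Set S2) := {R | ∃ x ∈ L.imageᶜ, R = connectedComponentIn L.imageᶜ x}

/-- Two regions are connected when they share a crossing on their boundaries. -/
def RegionsConnected (R R' : Set S2) : Prop := ∃ p ∈ L.crossings, p ∈ frontier R ∧ p ∈ frontier R'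

/-- Two regions are disconnected when they share no crossing on their boundaries. -/
def RegionsDisconnected (R R' : Set S2) : Prop := ¬ L.RegionsConnected R R'

/-- A set of regions is isolated when any two different regions in it are disconnected. -/
def IsIsolated (W : Set (Set S2)) : Prop := W ⊆ L.regions ∧ W.Pairwise L.RegionsDisconnected

/-- The isolate-region number `I(L)`: the maximum of the cardinalities of the isolated sets of
regions. -/
noncomputable def isolateRegionNumber : ℕ∞ := ⨆ W : {W : Set (Set S2) // L.IsIsolated W}, W.1.encard

/-- `L` is a split sum when it is the union of two nonempty link projections that do not meet:
its components can be divided into two nonempty classes such that no component of the first class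
meets a component of the second. -/
def IsSplitSum : Prop :=
  ∃ S : Set (Fin L.components), S.Nonempty ∧ Sᶜ.Nonempty ∧
    Disjoint (L.curve '' (S ×ˢ univ)) (L.curve '' (Sᶜ ×ˢ univ))

/-- `L` is connected when it is not a split sum. -/
def Connected : Prop := ¬ L.IsSplitSum

/-- A crossing is reducible when there are exactly three regions around it. -/
def IsReducibleCrossing (p : S2) : Prop :=
  p ∈ L.crossings ∧ {R ∈ L.regions | p ∈ frontier R}.encard = 3

/-- `L` is reducible when it has a reducible crossing. -/
def Reducible : Prop := ∃ p, L.IsReducibleCrossing p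

/-- `L` is irreducible when it is not reducible. -/
def Irreducible : Prop := ¬ L.Reducible

end LinkProjection

end LinkProj

namespace LinkProj

/-! The projection is a 4-valent graph on the sphere, and the theorem follows from counting its
regions. Call the number of crossings on the boundary of a region its degree.

Only one half of Euler's formula is needed: C crossings force at least C + 2 regions
(`Diagram.card_add_two_le`). This is linear algebra over `ZMod 2`. There are 2C edges and the
boundary map to the crossings has rank at most C - 1, so the mod 2 cycles have dimension at least C
+ 1. Every cycle is the set of edges across which some 2-colouring of the regions changes
(`exists_coloring`), and colourings modulo constants have dimension at most the number of regions
minus 1. That cycles come from colourings is the vanishing of the first cohomology of the punctured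
sphere: local colourings are glued by a section of a covering of a simply connected space
(`exists_glued_function`).

The same principle, together with irreducibility, shows that the four corners at a crossing belong
to four different regions (`Diagram.corner_injective`). Hence the degrees add up to 4C, each degree
is at least 2, and a region of degree d shares crossings with at most 2d others
(`Diagram.card_neighbors_le`).

With C ≥ 13 there are at least 15 regions, so two disconnected regions of small total degree leave a
third one disconnected from both. If no such triple exists, a region of degree 2 forces degree at
least 5 on all regions disconnected from it; if the minimal degree is 3, a region of degree 3 forces
degree at least 4 on them. Either way the degrees add up to more than 4C (`Diagram.exists_three`).
-/

/-! ### Gluing local functions on a simply connected space -/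

open Filter in
/-- On a simply connected space, locally defined functions on a dense subset that differ by
locally constant functions can be corrected to a globally defined function. -/
theorem exists_glued_function {Y ι G : Type*} [TopologicalSpace Y] [SimplyConnectedSpace Y]
    [LocallyPathConnectedSpace Y] [AddCommGroup G] [TopologicalSpace G] [DiscreteTopology G]
    {D : Set Y} (hD : Dense D) (U : ι → Set Y) (hU : ∀ i, IsOpen (U i)) (idx : Y → ι)
    (hidx : ∀ y, y ∈ U (idx y)) (c : ι → Y → G)
    (H : ∀ i j, ∀ y ∈ U i ∩ U j, ∃ k, ∀ᶠ y' in 𝓝[D] y, c i y' - c j y' = k) :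
    ∃ f : Y → G, ∀ i, ∀ y ∈ U i, ∃ k, ∀ᶠ y' in 𝓝[D] y, f y' - c i y' = k := by
  classical
  have hne : ∀ y, (𝓝[D] y).NeBot := fun y => mem_closure_iff_nhdsWithin_neBot.1 (hD y)
  have huniq : ∀ {y : Y} {f : Y → G} {k k' : G}, (∀ᶠ y' in 𝓝[D] y, f y' = k) →
      (∀ᶠ y' in 𝓝[D] y, f y' = k') → k = k' := by
    intro y f k k' h h'
    obtain ⟨y', h1, h2⟩ := (h.and h').exists
    exact h1.symm.trans h2
  choose! g hg using H
  -- The fibre coordinate over `U i` stands for the difference between the function sought and `c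
  -- i`, so passing from `i` to `j` adds `c i - c j`. These differences are locally constant and the
  -- fibre is discrete, so the bundle is a covering.
  let Z : FiberBundleCore ι Y G :=
    { baseSet := U
      isOpen_baseSet := hU
      indexAt := idx
      mem_baseSet_at := hidx
      coordChange := fun i j y a => a + g i j y
      coordChange_self := by
        intro i y hy v
        have : g i i y = 0 := huniq (hg i i y ⟨hy, hy⟩) (by simp)
        simp [this]
      continuousOn_coordChange := by
        intro i j
        apply ContinuousOn.add continuousOn_snd
        refine ContinuousOn.comp (t := U i ∩ U j) (f := Prod.fst) (g := g i j) ?_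
          continuousOn_fst (fun p hp => hp.1)
        intro y hy
        apply ContinuousAt.continuousWithinAt
        have hloc : ∀ᶠ y' in 𝓝 y, g i j y' = g i j y := by
          have h1 := eventually_eventually_nhdsWithin.2 (hg i j y hy)
          have h2 : ∀ᶠ y' in 𝓝 y, y' ∈ U i ∩ U j := ((hU i).inter (hU j)).mem_nhds hy
          have h3 := eventually_nhdsWithin_iff.1 (hg i j y hy)
          filter_upwards [eventually_eventually_nhds.2 h3, h2] with y' hy' hm
          exact huniq (hg i j y' hm) (eventually_nhdsWithin_iff.2 hy')
        exact (continuousAt_const (y := g i j y)).congr (hloc.mono fun _ h => h.symm)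
      coordChange_comp := by
        intro i j k y hy v
        have : g i k y = g i j y + g j k y := by
          refine huniq (hg i k y ⟨hy.1.1, hy.2⟩) ?_
          filter_upwards [hg i j y hy.1, hg j k y ⟨hy.1.2, hy.2⟩] with y' h1 h2
          rw [← h1, ← h2]; abel
        simp only [this]; abel }
  have hcov : IsCoveringMap (Bundle.TotalSpace.proj : Z.TotalSpace → Y) :=
    FiberBundle.isCoveringMap (F := G) (E := Z.Fiber)
  obtain ⟨y₀⟩ : Nonempty Y := inferInstance
  -- Simple connectivity lifts the identity to a section, which supplies the corrections.
  obtain ⟨F, ⟨-, hF⟩, -⟩ := hcov.existsUnique_continuousMap_lifts (ContinuousMap.id Y) y₀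
    (⟨y₀, (0 : G)⟩ : Z.TotalSpace) rfl
  have hF1 : ∀ y, (F y).1 = y := fun y => congrFun hF y
  let S : Y → G := fun y => (F y).2
  refine ⟨fun y => c (idx y) y + S y, fun i y hy => ?_⟩
  have hcont : ContinuousAt (fun y' => (Z.localTriv i (F y')).2) y := by
    apply continuousAt_snd.comp
    apply ContinuousAt.comp _ F.continuous.continuousAt
    apply (Z.localTriv i).continuousAt
    rw [Z.mem_localTriv_source]
    change (F y).1 ∈ U i
    rwa [hF1]
  refine ⟨(Z.localTriv i (F y)).2, ?_⟩
  have hev : ∀ᶠ y' in 𝓝 y, (Z.localTriv i (F y')).2 = (Z.localTriv i (F y)).2 :=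
    hcont.eventually (IsOpen.mem_nhds (isOpen_discrete {_}) rfl)
  rw [eventually_nhdsWithin_iff]
  filter_upwards [hev, (hU i).mem_nhds hy] with y' h1 h2 h3
  rw [← h1, Z.localTriv_apply]
  change _ = S y' + g (idx (F y').1) i (F y').1
  rw [hF1]
  have := (hg (idx y') i y' ⟨hidx y', h2⟩).self_of_nhdsWithin h3
  rw [← this]
  abel_nf

/-! ### Neighbourhoods cut into two sides or four quadrants -/

section Boxes

variable {S : Type*} [TopologicalSpace S]

/-- `U` is an open set that is cut by `K` into the two sides `A` and `B`. -/
structure IsFlatBox (K U A B : Set S) : Prop where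
  isOpen : IsOpen U
  isOpen_left : IsOpen A
  isOpen_right : IsOpen B
  disjoint : Disjoint A B
  isPreconnected_left : IsPreconnected A
  isPreconnected_right : IsPreconnected B
  union_eq : A ∪ B = U \ K
  subset_left : U ∩ K ⊆ closure A
  subset_right : U ∩ K ⊆ closure B

/-- The point `q` has arbitrarily small neighbourhoods that are cut by `K` into two sides. -/
def IsFlatPoint (K : Set S) (q : S) : Prop :=
  ∀ W ∈ 𝓝 q, ∃ U A B, q ∈ U ∧ U ⊆ W ∧ IsFlatBox K U A B

/-- `U` is an open neighbourhood of `p` that is cut by `K` into four quadrants `Q k`, where `V k` is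
a neighbourhood of the arm that separates `Q k` from `Q (k + 1)`. -/
structure IsCrossBox (K U : Set S) (p : S) (Q V : ZMod 4 → Set S) : Prop where
  isOpen : IsOpen U
  mem : p ∈ U
  flat : ∀ k, IsFlatBox K (V k) (Q k) (Q (k + 1))
  eq_union : U = {p} ∪ ⋃ k, V k
  mem_closure : ∀ k, p ∈ closure (Q k)
  disjoint : Pairwise fun k l => Disjoint (Q k) (Q l)
  arm_nonempty : ∀ k, (V k ∩ K).Nonempty
  flatPoint : ∀ k, ∀ q ∈ V k, IsFlatPoint K q

variable {K U A B U' A' B' : Set S} {q : S}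

theorem IsFlatBox.symm (h : IsFlatBox K U A B) : IsFlatBox K U B A :=
  ⟨h.isOpen, h.isOpen_right, h.isOpen_left, h.disjoint.symm, h.isPreconnected_right,
    h.isPreconnected_left, by rw [union_comm, h.union_eq], h.subset_right, h.subset_left⟩

theorem IsFlatBox.left_subset (h : IsFlatBox K U A B) : A ⊆ U \ K :=
  h.union_eq ▸ subset_union_left

theorem IsFlatBox.right_subset (h : IsFlatBox K U A B) : B ⊆ U \ K :=
  h.union_eq ▸ subset_union_right

theorem IsFlatBox.left_nonempty (h : IsFlatBox K U A B) (hq : q ∈ U ∩ K) : A.Nonempty :=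
  closure_nonempty_iff.1 ⟨q, h.subset_left hq⟩

theorem IsFlatBox.right_nonempty (h : IsFlatBox K U A B) (hq : q ∈ U ∩ K) : B.Nonempty :=
  closure_nonempty_iff.1 ⟨q, h.subset_right hq⟩

theorem IsFlatBox.subset_or (h : IsFlatBox K U A B) {T : Set S} (hT : IsPreconnected T)
    (hTU : T ⊆ U \ K) : T ⊆ A ∨ T ⊆ B := by
  rw [← h.union_eq] at hTU
  exact hT.subset_or_subset h.isOpen_left h.isOpen_right h.disjoint hTU

/-- The sides of a smaller box are contained in the sides of the larger box. -/
theorem IsFlatBox.sides_subset (h : IsFlatBox K U A B) (h' : IsFlatBox K U' A' B') (hU : U' ⊆ U)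
    (hq : q ∈ U' ∩ K) : (A' ⊆ A ∧ B' ⊆ B) ∨ (A' ⊆ B ∧ B' ⊆ A) := by
  have hsub : U' \ K ⊆ U \ K := sdiff_subset_sdiff_left hU
  have key : ∀ {X Y : Set S}, IsFlatBox K U X Y → ¬ (A' ⊆ X ∧ B' ⊆ X) := by
    -- The open set `U'` contains a point of the closure of `Y`, so it meets `Y` and cannot have
    -- both its sides in `X`.
    rintro X Y hXY ⟨h1, h2⟩
    obtain ⟨y, hyU, hyY⟩ := mem_closure_iff.1 (hXY.subset_right ⟨hU hq.1, hq.2⟩) U' h'.isOpen hq.1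
    have : y ∈ A' ∪ B' := h'.union_eq ▸ ⟨hyU, (hXY.right_subset hyY).2⟩
    have hyX : y ∈ X := this.elim (fun h => h1 h) (fun h => h2 h)
    exact disjoint_left.1 hXY.disjoint hyX hyY
  rcases h.subset_or h'.isPreconnected_left (h'.left_subset.trans hsub) with h1 | h1 <;>
  rcases h.subset_or h'.isPreconnected_right (h'.right_subset.trans hsub) with h2 | h2
  · exact (key h ⟨h1, h2⟩).elim
  · exact .inl ⟨h1, h2⟩
  · exact .inr ⟨h1, h2⟩
  · exact (key h.symm ⟨h1, h2⟩).elim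

variable {p : S} {Q V : ZMod 4 → Set S}

theorem IsCrossBox.arm_subset (h : IsCrossBox K U p Q V) (k : ZMod 4) : V k ⊆ U := by
  rw [h.eq_union]
  exact (subset_iUnion V k).trans subset_union_right

theorem IsCrossBox.quadrant_subset (h : IsCrossBox K U p Q V) (k : ZMod 4) : Q k ⊆ U \ K :=
  (h.flat k).left_subset.trans (sdiff_subset_sdiff_left (h.arm_subset k))

theorem IsCrossBox.diff_subset (h : IsCrossBox K U p Q V) (hp : p ∈ K) : U \ K ⊆ ⋃ k, Q k := by
  rintro x ⟨hxU, hxK⟩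
  rw [h.eq_union] at hxU
  rcases hxU with rfl | hx
  · exact (hxK hp).elim
  · obtain ⟨k, hk⟩ := mem_iUnion.1 hx
    have : x ∈ Q k ∪ Q (k + 1) := (h.flat k).union_eq ▸ ⟨hk, hxK⟩
    exact this.elim (fun h => mem_iUnion_of_mem _ h) (fun h => mem_iUnion_of_mem _ h)

theorem IsCrossBox.subset_quadrant (h : IsCrossBox K U p Q V) (hp : p ∈ K) {T : Set S}
    (hT : IsPreconnected T) (hTU : T ⊆ U \ K) : ∃ k, T ⊆ Q k := by
  rcases T.eq_empty_or_nonempty with rfl | ⟨x, hx⟩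
  · exact ⟨0, empty_subset _⟩
  have hsub := hTU.trans (h.diff_subset hp)
  obtain ⟨k, hk⟩ := mem_iUnion.1 (hsub hx)
  have ho : ∀ l, IsOpen (Q l) := fun l => (h.flat l).isOpen_left
  refine ⟨k, hT.subset_left_of_subset_union (ho k) (isOpen_iUnion fun l : {l // l ≠ k} => ho l)
    ?_ (fun y hy => ?_) ⟨x, hx, hk⟩⟩
  · exact disjoint_iUnion_right.2 fun l => h.disjoint l.2.symm
  · obtain ⟨l, hl⟩ := mem_iUnion.1 (hsub hy)
    by_cases hlk : l = k
    · exact .inl (hlk ▸ hl)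
    · exact .inr (mem_iUnion.2 ⟨⟨l, hlk⟩, hl⟩)

/-- All four quadrants accumulate at `p`, while a flat box around `p` has only two connected sides,
each inside a single quadrant. -/
theorem IsCrossBox.not_isFlatPoint (h : IsCrossBox K U p Q V) (hp : p ∈ K) :
    ¬ IsFlatPoint K p := by
  intro hflat
  obtain ⟨U', A, B, hpU', hU', hbox⟩ := hflat U (h.isOpen.mem_nhds h.mem)
  have hsub : U' \ K ⊆ U \ K := sdiff_subset_sdiff_left hU'
  obtain ⟨i, hi⟩ := h.subset_quadrant hp hbox.isPreconnected_left (hbox.left_subset.trans hsub)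
  obtain ⟨j, hj⟩ := h.subset_quadrant hp hbox.isPreconnected_right (hbox.right_subset.trans hsub)
  obtain ⟨k, hki, hkj⟩ : ∃ k, k ≠ i ∧ k ≠ j := (by decide : ∀ i j : ZMod 4, ∃ k, k ≠ i ∧ k ≠ j) i j
  obtain ⟨y, hyU, hyQ⟩ := mem_closure_iff.1 (h.mem_closure k) U' hbox.isOpen hpU'
  have : y ∈ A ∪ B := hbox.union_eq ▸ ⟨hyU, (h.quadrant_subset k hyQ).2⟩
  rcases this with hy | hy
  · exact disjoint_left.1 (h.disjoint hki) hyQ (hi hy)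
  · exact disjoint_left.1 (h.disjoint hkj) hyQ (hj hy)

end Boxes

/-! ### Boxes obtained from local coordinates -/

section Charts

variable {S : Type*} [TopologicalSpace S] {K : Set S} (e : OpenPartialHomeomorph S (ℝ × ℝ))

/-- Convexity of `C` makes both sides connected, and moving along `±v` leaves the line `l = 0` to
either side. A general functional `l` serves simple points and all four arms of a crossing alike. -/
theorem isFlatBox_symm_image {C : Set (ℝ × ℝ)} (hC : IsOpen C) (hconv : Convex ℝ C)
    (hCe : C ⊆ e.target) (l : ℝ × ℝ →L[ℝ] ℝ) {v : ℝ × ℝ} (hv : l v = 1)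
    (hK : ∀ y ∈ C, e.symm y ∈ K ↔ l y = 0) :
    IsFlatBox K (e.symm '' C) (e.symm '' (C ∩ {y | 0 < l y})) (e.symm '' (C ∩ {y | l y < 0})) := by
  have hop : ∀ {T}, IsOpen T → T ⊆ C → IsOpen (e.symm '' T) := fun hT hTC =>
    e.symm.isOpen_image_of_subset_source hT (hTC.trans hCe)
  have hpre : ∀ {T}, Convex ℝ T → T ⊆ C → IsPreconnected (e.symm '' T) := fun hT hTC =>
    hT.isPreconnected.image _ (e.continuousOn_symm.mono (hTC.trans hCe))
  have hclo : ∀ s : ℝ, s ≠ 0 → e.symm '' C ∩ K ⊆ closure (e.symm '' (C ∩ {y | 0 < s * l y})) := by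
    rintro s hs _ ⟨⟨y, hy, rfl⟩, hyK⟩
    rw [hK y hy] at hyK
    have hy' : y ∈ closure (C ∩ {y | 0 < s * l y}) := by
      have ht : Filter.Tendsto (fun t : ℝ => y + (t * s) • v) (𝓝[>] 0) (𝓝 y) := by
        have : Continuous fun t : ℝ => y + (t * s) • v := by fun_prop
        have h0 := this.tendsto 0
        simp only [zero_mul, zero_smul, add_zero] at h0
        exact h0.mono_left nhdsWithin_le_nhds
      refine mem_closure_of_tendsto ht ?_
      filter_upwards [ht (hC.mem_nhds hy), self_mem_nhdsWithin] with t h1 h2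
      refine ⟨h1, ?_⟩
      have : 0 < s * s := mul_self_pos.2 hs
      simp only [mem_ofPred_eq, map_add, map_smul, hyK, hv, smul_eq_mul]
      have h2' : 0 < t := h2
      nlinarith [mul_pos h2' this]
    exact (e.continuousOn_symm.continuousAt (e.open_target.mem_nhds (hCe hy))).continuousWithinAt
      |>.mem_closure_image hy'
  refine ⟨hop hC subset_rfl, ?_, ?_, ?_, ?_, ?_, ?_, ?_, ?_⟩
  · exact hop (hC.inter (isOpen_lt continuous_const l.continuous)) inter_subset_left
  · exact hop (hC.inter (isOpen_lt l.continuous continuous_const)) inter_subset_left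
  · rw [disjoint_left]
    rintro _ ⟨y, ⟨hy, hy0⟩, rfl⟩ ⟨z, ⟨hz, hz0⟩, hzy⟩
    have := e.symm.injOn (hCe hz) (hCe hy) hzy
    subst this
    exact lt_asymm (show 0 < l z from hy0) hz0
  · exact hpre (hconv.inter (convex_halfSpace_gt l.isLinear 0)) inter_subset_left
  · exact hpre (hconv.inter (convex_halfSpace_lt l.isLinear 0)) inter_subset_left
  · ext x
    constructor
    · rintro (⟨y, ⟨hy, hy0⟩, rfl⟩ | ⟨y, ⟨hy, hy0⟩, rfl⟩)
      · exact ⟨mem_image_of_mem _ hy, fun h => hy0.ne' ((hK y hy).1 h)⟩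
      · exact ⟨mem_image_of_mem _ hy, fun h => hy0.ne ((hK y hy).1 h)⟩
    · rintro ⟨⟨y, hy, rfl⟩, hyK⟩
      rw [hK y hy] at hyK
      rcases lt_or_gt_of_ne hyK with h | h
      · exact .inr ⟨y, ⟨hy, h⟩, rfl⟩
      · exact .inl ⟨y, ⟨hy, h⟩, rfl⟩
  · simpa using hclo 1 one_ne_zero
  · simpa using hclo (-1) (by norm_num)

theorem isFlatPoint_symm {C : Set (ℝ × ℝ)} (hC : IsOpen C) (hCe : C ⊆ e.target)
    (l : ℝ × ℝ →L[ℝ] ℝ) {v : ℝ × ℝ} (hv : l v = 1)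
    (hK : ∀ y ∈ C, e.symm y ∈ K ↔ l y = 0) {y : ℝ × ℝ} (hy : y ∈ C) :
    IsFlatPoint K (e.symm y) := by
  intro W hW
  have hc := e.continuousOn_symm.continuousAt (e.open_target.mem_nhds (hCe hy))
  obtain ⟨r, hr, hball⟩ := Metric.mem_nhds_iff.1 (Filter.inter_mem (hc hW) (hC.mem_nhds hy))
  have hb : Metric.ball y r ⊆ C := fun z hz => (hball hz).2
  refine ⟨_, _, _, mem_image_of_mem _ (Metric.mem_ball_self hr), ?_,
    isFlatBox_symm_image e Metric.isOpen_ball (convex_ball y r) (hb.trans hCe) l hv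
      fun z hz => hK z (hb hz)⟩
  rintro _ ⟨z, hz, rfl⟩
  exact (hball hz).1

/-- The functional that is positive in the direction of the `k`-th arm of the standard cross. -/
def armForm : ZMod 4 → (ℝ × ℝ →L[ℝ] ℝ) :=
  ![.fst ℝ ℝ ℝ, .snd ℝ ℝ ℝ, -.fst ℝ ℝ ℝ, -.snd ℝ ℝ ℝ]

theorem armForm_add_two (k : ZMod 4) (y : ℝ × ℝ) : armForm (k + 2) y = -armForm k y := by
  fin_cases k
  · rfl
  · rfl
  · exact (neg_neg y.1).symm
  · exact (neg_neg y.2).symm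

/-- Describes the cross as seen from arm `k`, so that the arms can be treated uniformly: where
`armForm k` is positive, only the second alternative remains. -/
theorem cross_iff (k : ZMod 4) (y : ℝ × ℝ) :
    (y.1 = 0 ∨ y.2 = 0) ↔ armForm k y = 0 ∨ armForm (k - 1) y = 0 := by
  fin_cases k
  · exact or_congr Iff.rfl neg_eq_zero.symm
  · exact or_comm
  · exact (or_congr neg_eq_zero.symm Iff.rfl)
  · exact or_comm.trans (or_congr neg_eq_zero.symm neg_eq_zero.symm)

theorem exists_armForm_pos (k : ZMod 4) :
    ∃ v, 0 < armForm k v ∧ 0 < armForm (k - 1) v := by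
  fin_cases k
  · exact ⟨(1, -1), one_pos, (by norm_num : (0 : ℝ) < - -1)⟩
  · exact ⟨(1, 1), one_pos, one_pos⟩
  · exact ⟨(-1, 1), (by norm_num : (0 : ℝ) < - -1), one_pos⟩
  · exact ⟨(-1, -1), (by norm_num : (0 : ℝ) < - -1), (by norm_num : (0 : ℝ) < - -1)⟩

theorem exists_armForm_pos_of_ne_zero {y : ℝ × ℝ} (hy : y ≠ 0) : ∃ k, 0 < armForm k y := by
  by_contra! h
  have h0 : y.1 ≤ 0 := h 0
  have h1 : y.2 ≤ 0 := h 1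
  have h2 : -y.1 ≤ 0 := h 2
  have h3 : -y.2 ≤ 0 := h 3
  exact hy (Prod.ext (by simp; linarith) (by simp; linarith))

theorem exists_armForm_eq_one (k : ZMod 4) :
    ∃ v, armForm k v = 0 ∧ armForm (k - 1) v = 1 := by
  fin_cases k
  · exact ⟨(0, -1), rfl, neg_neg (1 : ℝ)⟩
  · exact ⟨(1, 0), rfl, rfl⟩
  · exact ⟨(0, 1), neg_zero, rfl⟩
  · exact ⟨(-1, 0), neg_zero, neg_neg (1 : ℝ)⟩

/-- The neighbourhood of the `k`-th arm. -/
def chartArm (r : ℝ) (k : ZMod 4) : Set S :=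
  e.symm '' (Metric.ball 0 r ∩ {y | 0 < armForm k y})

/-- The `k`-th quadrant. -/
def chartQuadrant (r : ℝ) (k : ZMod 4) : Set S :=
  e.symm '' (Metric.ball 0 r ∩ {y | 0 < armForm k y} ∩ {y | 0 < armForm (k - 1) y})

variable {e} {r : ℝ}

/-- The half-ball around arm `k` is cut by `armForm (k - 1)`: its positive part is quadrant `k`, its
negative part quadrant `k + 1`, because `armForm (k + 1) = -armForm (k - 1)`. -/
theorem isCrossBox_chart (hr : 0 < r) (hre : Metric.ball 0 r ⊆ e.target)
    (hK : ∀ y ∈ Metric.ball 0 r, e.symm y ∈ K ↔ y.1 = 0 ∨ y.2 = 0) :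
    IsCrossBox K (e.symm '' Metric.ball 0 r) (e.symm 0) (chartQuadrant e r) (chartArm e r) := by
  have h0 : (0 : ℝ × ℝ) ∈ Metric.ball 0 r := Metric.mem_ball_self hr
  have hsmall : ∀ u : ℝ × ℝ, ∀ᶠ t in 𝓝[>] (0 : ℝ), t • u ∈ Metric.ball 0 r := by
    intro u
    have : Continuous fun t : ℝ => t • u := by fun_prop
    have h1 := this.tendsto 0
    simp only [zero_smul] at h1
    exact (h1.mono_left nhdsWithin_le_nhds) (Metric.isOpen_ball.mem_nhds h0)
  have hopen : ∀ k, IsOpen (Metric.ball 0 r ∩ {y | 0 < armForm k y}) := fun k =>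
    Metric.isOpen_ball.inter (isOpen_lt continuous_const (armForm k).continuous)
  have hKk : ∀ k, ∀ y ∈ Metric.ball 0 r ∩ {y | 0 < armForm k y},
      e.symm y ∈ K ↔ armForm (k - 1) y = 0 := by
    rintro k y ⟨hy, hy0⟩
    rw [hK y hy, cross_iff k]
    exact or_iff_right (ne_of_gt hy0)
  have hneg : ∀ k y, armForm (k + 1) y = - armForm (k - 1) y := by
    intro k y
    rw [← armForm_add_two]
    congr 2
    ring
  refine ⟨?_, mem_image_of_mem _ h0, fun k => ?_, ?_, fun k => ?_, ?_, fun k => ?_, ?_⟩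
  · exact e.symm.isOpen_image_of_subset_source Metric.isOpen_ball hre
  · obtain ⟨v, -, hv⟩ := exists_armForm_eq_one k
    have := isFlatBox_symm_image e (hopen k)
      ((convex_ball 0 r).inter (convex_halfSpace_gt (armForm k).isLinear 0))
      (inter_subset_left.trans hre) (armForm (k - 1)) hv (hKk k)
    have hQ : chartQuadrant e r (k + 1) =
        e.symm '' (Metric.ball 0 r ∩ {y | 0 < armForm k y} ∩ {y | armForm (k - 1) y < 0}) := by
      unfold chartQuadrant
      congr 1
      ext y
      simp only [mem_inter_iff, mem_ofPred_eq, hneg, add_sub_cancel_right, neg_pos]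
      tauto
    rw [hQ]
    exact this
  · ext x
    constructor
    · rintro ⟨y, hy, rfl⟩
      by_cases hy0 : y = 0
      · exact .inl (hy0 ▸ rfl)
      · obtain ⟨k, hk⟩ := exists_armForm_pos_of_ne_zero hy0
        exact .inr (mem_iUnion.2 ⟨k, y, ⟨hy, hk⟩, rfl⟩)
    · rintro (rfl | hx)
      · exact mem_image_of_mem _ h0
      · obtain ⟨k, y, ⟨hy, -⟩, rfl⟩ := mem_iUnion.1 hx
        exact mem_image_of_mem _ hy
  · obtain ⟨v, hv1, hv2⟩ := exists_armForm_pos k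
    have hcl : (0 : ℝ × ℝ) ∈ closure
        (Metric.ball 0 r ∩ {y | 0 < armForm k y} ∩ {y | 0 < armForm (k - 1) y}) := by
      have : Continuous fun t : ℝ => t • v := by fun_prop
      have h1 := this.tendsto 0
      simp only [zero_smul] at h1
      refine mem_closure_of_tendsto (h1.mono_left (nhdsWithin_le_nhds (s := Ioi 0))) ?_
      filter_upwards [hsmall v, self_mem_nhdsWithin] with t h1 h2
      have h2' : 0 < t := h2
      refine ⟨⟨h1, ?_⟩, ?_⟩
      · simpa using mul_pos h2' hv1
      · simpa using mul_pos h2' hv2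
    exact (e.continuousOn_symm.continuousAt (e.open_target.mem_nhds (hre h0))).continuousWithinAt
      |>.mem_closure_image hcl
  · intro k l hkl
    rw [disjoint_left]
    rintro _ ⟨y, ⟨⟨hy, hk⟩, hk'⟩, rfl⟩ ⟨z, ⟨⟨hz, hl⟩, hl'⟩, hzy⟩
    have := e.symm.injOn (hre hz) (hre hy) hzy
    subst this
    have hk1 : 0 < armForm k z := hk
    have hk2 : 0 < armForm (k - 1) z := hk'
    have hl1 : 0 < armForm l z := hl
    have hl2 : 0 < armForm (l - 1) z := hl'
    have h3 := armForm_add_two k z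
    have h4 := armForm_add_two (k - 1) z
    -- For different quadrants, some form positive on one is the negative of a form positive on the
    -- other.
    rcases (by decide : ∀ k l : ZMod 4, k ≠ l → l = k + 2 ∨ l = k - 1 + 2 ∨ l - 1 = k + 2) k l hkl
      with h | h | h
    · subst h; linarith
    · subst h; linarith
    · rw [h] at hl2; linarith
  · obtain ⟨v, hv1, hv2⟩ := exists_armForm_eq_one (k + 1)
    rw [add_sub_cancel_right] at hv2
    obtain ⟨t, h1, h2⟩ := ((hsmall v).and self_mem_nhdsWithin).exists
    have h2' : 0 < t := h2
    have hmem : t • v ∈ Metric.ball 0 r ∩ {y | 0 < armForm k y} := ⟨h1, by simpa [hv2] using h2'⟩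
    refine ⟨_, mem_image_of_mem _ hmem, (hKk k _ hmem).2 ?_⟩
    have := hneg k v
    simp only [map_smul, smul_eq_mul, mul_eq_zero]
    exact .inr (by linarith)
  · rintro k _ ⟨y, hy, rfl⟩
    obtain ⟨v, -, hv⟩ := exists_armForm_eq_one k
    exact isFlatPoint_symm e (hopen k) (inter_subset_left.trans hre) _ hv (hKk k) hy

end Charts

/-! ### Mod 2 colourings with prescribed jumps -/

section Colorings

open Filter

variable {S : Type*} [TopologicalSpace S] {K : Set S}

/-- The function `c` on the complement of `K` jumps by `k` when `K` is passed through at `q`. -/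
def HasJump (K : Set S) (c : S → ZMod 2) (q : S) (k : ZMod 2) : Prop :=
  ∃ U A B a, IsFlatBox K U A B ∧ q ∈ U ∧ (∀ x ∈ A, c x = a) ∧ ∀ x ∈ B, c x = a + k

theorem ZMod.add_add_self_two (a k : ZMod 2) : a + k + k = a := by
  revert a k; decide

variable {c c' : S → ZMod 2} {q : S} {k : ZMod 2}

/-- A jump is seen in arbitrarily small boxes. -/
theorem HasJump.exists_subset (h : HasJump K c q k) (hq : q ∈ K) (hflat : IsFlatPoint K q)
    {W : Set S} (hW : W ∈ 𝓝 q) : ∃ U ⊆ W, ∃ A B a, IsFlatBox K U A B ∧ q ∈ U ∧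
      (∀ x ∈ A, c x = a) ∧ ∀ x ∈ B, c x = a + k := by
  obtain ⟨U, A, B, a, hbox, hqU, hA, hB⟩ := h
  obtain ⟨U', A', B', hqU', hU', hbox'⟩ := hflat (U ∩ W) (inter_mem (hbox.isOpen.mem_nhds hqU) hW)
  refine ⟨U', hU'.trans inter_subset_right, A', B', ?_⟩
  rcases hbox.sides_subset hbox' (hU'.trans inter_subset_left) ⟨hqU', hq⟩ with ⟨h1, h2⟩ | ⟨h1, h2⟩
  · exact ⟨a, hbox', hqU', fun x hx => hA x (h1 hx), fun x hx => hB x (h2 hx)⟩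
  · refine ⟨a + k, hbox', hqU', fun x hx => hB x (h1 hx), fun x hx => ?_⟩
    rw [hA x (h2 hx), ZMod.add_add_self_two]

/-- In a box on whose sides `c` is constant, the two values differ by the jump. -/
theorem HasJump.eq_add (h : HasJump K c q k) (hq : q ∈ K) (hflat : IsFlatPoint K q)
    {U A B : Set S} (hbox : IsFlatBox K U A B) (hqU : q ∈ U) {a b : ZMod 2}
    (hA : ∀ x ∈ A, c x = a) (hB : ∀ x ∈ B, c x = b) : b = a + k := by
  obtain ⟨U', hU', A', B', a', hbox', hqU', hA', hB'⟩ :=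
    h.exists_subset hq hflat (hbox.isOpen.mem_nhds hqU)
  obtain ⟨x, hx⟩ := hbox'.left_nonempty ⟨hqU', hq⟩
  obtain ⟨y, hy⟩ := hbox'.right_nonempty ⟨hqU', hq⟩
  rcases hbox.sides_subset hbox' hU' ⟨hqU', hq⟩ with ⟨h1, h2⟩ | ⟨h1, h2⟩
  · rw [← hA x (h1 hx), ← hB y (h2 hy), hA' x hx, hB' y hy]
  · rw [← hA y (h2 hy), ← hB x (h1 hx), hA' x hx, hB' y hy, ZMod.add_add_self_two]

/-- In a common small box both functions are constant on each side. The sides may be matched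
crosswise, which is harmless because a jump has no sign in `ZMod 2`. -/
theorem HasJump.exists_sub_eq (h : HasJump K c q k) (h' : HasJump K c' q k) (hq : q ∈ K)
    (hflat : IsFlatPoint K q) : ∃ m, ∀ᶠ x in 𝓝[Kᶜ] q, c x - c' x = m := by
  obtain ⟨U, A, B, a, hbox, hqU, hA, hB⟩ := h
  obtain ⟨U', hU', A', B', a', hbox', hqU', hA', hB'⟩ :=
    h'.exists_subset hq hflat (hbox.isOpen.mem_nhds hqU)
  have hev : ∀ᶠ x in 𝓝[Kᶜ] q, x ∈ A' ∪ B' := by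
    rw [eventually_nhdsWithin_iff]
    filter_upwards [hbox'.isOpen.mem_nhds hqU'] with x hx hxK
    exact hbox'.union_eq ▸ ⟨hx, hxK⟩
  rcases hbox.sides_subset hbox' hU' ⟨hqU', hq⟩ with ⟨h1, h2⟩ | ⟨h1, h2⟩
  · refine ⟨a - a', hev.mono ?_⟩
    rintro x (hx | hx)
    · rw [hA x (h1 hx), hA' x hx]
    · rw [hB x (h2 hx), hB' x hx]; abel
  · refine ⟨a + k - a', hev.mono ?_⟩
    rintro x (hx | hx)
    · rw [hB x (h1 hx), hA' x hx]
    · rw [hA x (h2 hx), hB' x hx]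
      exact (by decide : ∀ a a' k : ZMod 2, a - (a' + k) = a + k - a') a a' k

theorem HasJump.congr_of_eventually (h : HasJump K c q k) (hq : q ∈ K) (hflat : IsFlatPoint K q)
    {m : ZMod 2} (hm : ∀ᶠ x in 𝓝[Kᶜ] q, c' x - c x = m) : HasJump K c' q k := by
  obtain ⟨U, hU, A, B, a, hbox, hqU, hA, hB⟩ :=
    h.exists_subset hq hflat (eventually_nhdsWithin_iff.1 hm)
  refine ⟨U, A, B, m + a, hbox, hqU, fun x hx => ?_, fun x hx => ?_⟩
  · have := hbox.left_subset hx
    rw [← hU this.1 this.2, hA x hx]; abel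
  · have := hbox.right_subset hx
    rw [← hU this.1 this.2, hB x hx]
    abel

/-- `c` is a locally constant function on `U \ K` with prescribed jumps `j` outside the exceptional
set `E`. -/
structure IsLocalColoring (K E : Set S) (j : S → ZMod 2) (U : Set S) (c : S → ZMod 2) : Prop where
  isOpen : IsOpen U
  locConst : ∀ x ∈ U \ K, ∀ᶠ x' in 𝓝 x, c x' = c x
  hasJump : ∀ q ∈ (U ∩ K) \ E, HasJump K c q (j q)

theorem IsFlatBox.exists_coloring {U A B E : Set S} {j : S → ZMod 2} (hbox : IsFlatBox K U A B)
    (hj : ∀ q ∈ U ∩ K, j q = k) : ∃ c, IsLocalColoring K E j U c := by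
  classical
  have hA : ∀ x ∈ A, B.indicator (fun _ => k) x = 0 := fun x hx =>
    indicator_of_notMem (disjoint_left.1 hbox.disjoint hx) _
  have hB : ∀ x ∈ B, B.indicator (fun _ => k) x = k := fun x hx => indicator_of_mem hx _
  refine ⟨B.indicator fun _ => k, hbox.isOpen, fun x hx => ?_, fun q hq => ?_⟩
  · rw [← hbox.union_eq] at hx
    rcases hx with hx | hx
    · filter_upwards [hbox.isOpen_left.mem_nhds hx] with x' hx'
      rw [hA x hx, hA x' hx']
    · filter_upwards [hbox.isOpen_right.mem_nhds hx] with x' hx'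
      rw [hB x hx, hB x' hx']
  · refine ⟨U, A, B, 0, hbox, hq.1.1, hA, fun x hx => ?_⟩
    rw [hB x hx, hj q hq.1, zero_add]

theorem IsCrossBox.exists_coloring {U E : Set S} {p : S} {Q V : ZMod 4 → Set S}
    {j : S → ZMod 2} (hbox : IsCrossBox K U p Q V) (hpK : p ∈ K) (hpE : p ∈ E)
    {a : ZMod 4 → ZMod 2} (ha : ∑ i, a i = 0) (hj : ∀ i, ∀ q ∈ V i ∩ K, j q = a i) :
    ∃ c, IsLocalColoring K E j U c := by
  classical
  -- Going once round the crossing changes the colour by `∑ i, a i = 0`, so colours of the quadrants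
  -- can be chosen consistently.
  obtain ⟨b, hb⟩ : ∃ b : ZMod 4 → ZMod 2, ∀ i, b (i + 1) = b i + a i := by
    revert ha; clear hj; revert a; decide +revert
  let c : S → ZMod 2 := fun x => if h : ∃ i, x ∈ Q i then b h.choose else 0
  have hc : ∀ i, ∀ x ∈ Q i, c x = b i := by
    intro i x hx
    have h : ∃ i, x ∈ Q i := ⟨i, hx⟩
    have : h.choose = i := by
      by_contra hne
      exact disjoint_left.1 (hbox.disjoint hne) h.choose_spec hx
    simp only [c, dif_pos h, this]
  refine ⟨c, hbox.isOpen, fun x hx => ?_, fun q hq => ?_⟩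
  · obtain ⟨i, hi⟩ := mem_iUnion.1 (hbox.diff_subset hpK hx)
    filter_upwards [(hbox.flat i).isOpen_left.mem_nhds hi] with x' hx'
    rw [hc i x hi, hc i x' hx']
  · have hqU := hq.1.1
    rw [hbox.eq_union] at hqU
    rcases hqU with rfl | hqU
    · exact (hq.2 hpE).elim
    · obtain ⟨i, hi⟩ := mem_iUnion.1 hqU
      refine ⟨V i, Q i, Q (i + 1), b i, hbox.flat i, hi, hc i, fun x hx => ?_⟩
      rw [hc _ x hx, hb, hj i q ⟨hi, hq.1.2⟩]

/-- Near every point where the jumps are locally constant, or add up to zero, there is a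
coloring. -/
structure IsBalanced (K E : Set S) (j : S → ZMod 2) : Prop where
  subset : E ⊆ K
  dense : Dense Kᶜ
  isOpen : IsOpen Kᶜ
  flat : ∀ q ∈ K \ E, IsFlatPoint K q ∧ ∀ᶠ x in 𝓝 q, x ∈ K → x ∉ E ∧ j x = j q
  cross : ∀ p ∈ E, ∃ U Q V, IsCrossBox K U p Q V ∧
    ∃ a : ZMod 4 → ZMod 2, ∑ i, a i = 0 ∧ ∀ i, ∀ q ∈ V i ∩ K, q ∉ E ∧ j q = a i

variable {E : Set S} {j : S → ZMod 2}

/-- The clause `U ∩ E ⊆ {q}` prepares the gluing: a point of `E` then lies only in the set chosen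
for that point, so colourings never have to be compared there. -/
theorem IsBalanced.exists_localColoring (h : IsBalanced K E j) (q : S) :
    ∃ U c, q ∈ U ∧ U ∩ E ⊆ {q} ∧ IsLocalColoring K E j U c := by
  by_cases hqK : q ∈ K
  · by_cases hqE : q ∈ E
    · obtain ⟨U, Q, V, hbox, a, ha, hj⟩ := h.cross q hqE
      obtain ⟨c, hc⟩ := hbox.exists_coloring hqK hqE ha fun i q hq => (hj i q hq).2
      refine ⟨U, c, hbox.mem, ?_, hc⟩
      rintro x ⟨hxU, hxE⟩
      rw [hbox.eq_union] at hxU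
      rcases hxU with hx | hx
      · exact hx
      · obtain ⟨i, hi⟩ := mem_iUnion.1 hx
        exact ((hj i x ⟨hi, h.subset hxE⟩).1 hxE).elim
    · obtain ⟨hflat, hj⟩ := h.flat q ⟨hqK, hqE⟩
      obtain ⟨U, A, B, hqU, hU, hbox⟩ := hflat _ hj
      obtain ⟨c, hc⟩ := hbox.exists_coloring (E := E) fun x hx => (hU hx.1 hx.2).2
      exact ⟨U, c, hqU, fun x hx => ((hU hx.1 (h.subset hx.2)).1 hx.2).elim, hc⟩
  · refine ⟨Kᶜ, 0, hqK, fun x hx => (hx.1 (h.subset hx.2)).elim, h.isOpen, fun x _ => ?_, ?_⟩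
    · exact Eventually.of_forall fun _ => rfl
    · rintro x ⟨⟨hx, hx'⟩, -⟩
      exact (hx hx').elim

theorem IsBalanced.exists_sub_eq (h : IsBalanced K E j) {U U' : Set S} {c c' : S → ZMod 2}
    (hc : IsLocalColoring K E j U c) (hc' : IsLocalColoring K E j U' c') {q : S}
    (hq : q ∈ U ∩ U') (hqE : q ∉ E) : ∃ m, ∀ᶠ x in 𝓝[Kᶜ] q, c x - c' x = m := by
  by_cases hqK : q ∈ K
  · exact (hc.hasJump q ⟨⟨hq.1, hqK⟩, hqE⟩).exists_sub_eq (hc'.hasJump q ⟨⟨hq.2, hqK⟩, hqE⟩) hqK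
      (h.flat q ⟨hqK, hqE⟩).1
  · refine ⟨c q - c' q, nhdsWithin_le_nhds ?_⟩
    filter_upwards [hc.locConst q ⟨hq.1, hqK⟩, hc'.locConst q ⟨hq.2, hqK⟩] with x h1 h2
    rw [h1, h2]

/-- On an open subset that is homeomorphic to a simply connected space, balanced jumps are the
jumps of a locally constant function. -/
theorem IsBalanced.exists_coloring {Y : Type*} [TopologicalSpace Y] [SimplyConnectedSpace Y]
    [LocallyPathConnectedSpace Y] (h : IsBalanced K E j) (f : Y → S) (hf : IsOpenEmbedding f) :
    ∃ c : S → ZMod 2, (∀ x ∈ range f \ K, ∀ᶠ x' in 𝓝 x, c x' = c x) ∧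
      ∀ q ∈ (range f ∩ K) \ E, HasJump K c q (j q) := by
  choose U c hqU hUE hc using h.exists_localColoring
  have hmap : ∀ y, map f (𝓝[f ⁻¹' Kᶜ] y) = 𝓝[Kᶜ] (f y) := by
    intro y
    rw [hf.isInducing.map_nhdsWithin_eq, image_preimage_eq_inter_range,
      nhdsWithin_inter_of_mem']
    exact nhdsWithin_le_nhds (hf.isOpen_range.mem_nhds (mem_range_self y))
  obtain ⟨g, hg⟩ := exists_glued_function (D := f ⁻¹' Kᶜ) (h.dense.preimage hf.isOpenMap)
    (fun q => f ⁻¹' U q) (fun q => (hc q).isOpen.preimage hf.continuous) f (fun y => hqU _)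
    (fun q y => c q (f y)) (by
      rintro q q' y ⟨hy, hy'⟩
      by_cases hyE : f y ∈ E
      · have h1 : f y = q := hUE q ⟨hy, hyE⟩
        have h2 : f y = q' := hUE q' ⟨hy', hyE⟩
        exact ⟨0, by simp [← h1, ← h2]⟩
      · obtain ⟨m, hm⟩ := h.exists_sub_eq (hc q) (hc q') ⟨hy, hy'⟩ hyE
        rw [← hmap] at hm
        exact ⟨m, hm⟩)
  have hinv : ∀ y, (Function.extend f g 0) (f y) = g y := fun y => hf.injective.extend_apply _ _ _
  have key : ∀ y, ∃ m, ∀ᶠ x in 𝓝[Kᶜ] (f y), Function.extend f g 0 x - c (f y) x = m := by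
    intro y
    obtain ⟨m, hm⟩ := hg (f y) y (hqU _)
    refine ⟨m, ?_⟩
    rw [← hmap, eventually_map]
    filter_upwards [hm] with y' hy'
    rw [hinv, hy']
  refine ⟨Function.extend f g 0, ?_, ?_⟩
  · rintro _ ⟨⟨y, rfl⟩, hyK⟩
    obtain ⟨m, hm⟩ := key y
    have hKc : Kᶜ ∈ 𝓝 (f y) := h.isOpen.mem_nhds hyK
    rw [nhdsWithin_eq_nhds.2 hKc] at hm
    have h0 := hm.self_of_nhds
    filter_upwards [hm, (hc (f y)).locConst (f y) ⟨hqU _, hyK⟩] with x h1 h2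
    rw [h2, ← h0] at h1
    exact sub_left_inj.1 h1
  · rintro _ ⟨⟨⟨y, rfl⟩, hyK⟩, hyE⟩
    obtain ⟨m, hm⟩ := key y
    exact ((hc (f y)).hasJump (f y) ⟨⟨hqU _, hyK⟩, hyE⟩).congr_of_eventually hyK
      (h.flat _ ⟨hyK, hyE⟩).1 hm

end Colorings

/-- On the sphere, balanced jumps are the jumps of a locally constant function, except possibly
at a given point. -/
theorem IsBalanced.exists_coloring_sphere {K E : Set S2} {j : S2 → ZMod 2} (h : IsBalanced K E j)
    {v : S2} (hv : v ∈ K) : ∃ c : S2 → ZMod 2, (∀ x, x ∉ K → ∀ᶠ x' in 𝓝 x, c x' = c x) ∧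
      ∀ q ∈ K \ E, q ≠ v → HasJump K c q (j q) := by
  have hv1 : ‖(v : EuclideanSpace ℝ (Fin 3))‖ = 1 := by simp
  -- Stereographic projection from `v` identifies the rest of the sphere with a plane; this is why
  -- nothing is asserted at `v`.
  obtain ⟨c, hc1, hc2⟩ := h.exists_coloring _ (isOpenEmbedding_stereographic_symm hv1)
  rw [range_stereographic_symm hv1 v.2] at hc1 hc2
  have hne : ∀ x, x ≠ v → x ∈ ({⟨v, v.2⟩}ᶜ : Set S2) := fun x hx => hx
  exact ⟨c, fun x hx => hc1 x ⟨hne x fun hxv => hx (hxv ▸ hv), hx⟩,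
    fun q hq hqv => hc2 q ⟨⟨hne q hqv, hq.1⟩, hq.2⟩⟩

/-! ### Crossings and regions of a link projection -/

open Filter

instance : LocallyConnectedSpace S2 :=
  haveI : Fact (Module.finrank ℝ (EuclideanSpace ℝ (Fin 3)) = 2 + 1) := ⟨by simp⟩
  ChartedSpace.locallyConnectedSpace (EuclideanSpace ℝ (Fin 2)) S2

instance : PreconnectedSpace S2 :=
  Subtype.preconnectedSpace (isPreconnected_sphere (by
    rw [← Module.finrank_eq_rank, finrank_euclideanSpace_fin]; norm_num) 0 1)

namespace LinkProjection

variable (L : LinkProjection)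

theorem isClosed_image : IsClosed L.image :=
  (isCompact_range L.continuous_curve).isClosed

theorem crossings_subset : L.crossings ⊆ L.image := by
  rintro p ⟨s, -, -, rfl, -⟩
  exact mem_range_self s

variable {L} {p q : S2}

theorem isTransverseDoublePoint (hp : p ∈ L.crossings) : IsTransverseDoublePoint L.curve p := by
  refine (L.regular p (L.crossings_subset hp)).resolve_left ?_
  rintro ⟨h, -⟩
  obtain ⟨s, t, hst, hs, ht⟩ := hp
  exact hst (h.unique hs ht)

theorem isSimplePoint (hp : p ∈ L.image) (hpc : p ∉ L.crossings) : IsSimplePoint L.curve p := by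
  refine (L.regular p hp).resolve_right ?_
  rintro ⟨s, t, hst, h, -⟩
  have hs : s ∈ L.curve ⁻¹' {p} := h ▸ mem_insert s _
  have ht : t ∈ L.curve ⁻¹' {p} := h ▸ mem_insert_of_mem _ rfl
  exact hpc ⟨s, t, hst, hs, ht⟩

theorem eventually_isFlatPoint (hp : p ∈ L.image) (hpc : p ∉ L.crossings) :
    ∀ᶠ q in 𝓝 p, IsFlatPoint L.image q := by
  obtain ⟨-, e, hpe, -, he⟩ := isSimplePoint hp hpc
  filter_upwards [e.open_source.mem_nhds hpe] with q hq
  rw [← e.left_inv hq]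
  refine isFlatPoint_symm e e.open_target subset_rfl (.snd ℝ ℝ ℝ) (v := (0, 1)) rfl
    (fun y hy => ?_) (e.map_source hq)
  have := he (e.symm y) (e.map_target hy)
  rwa [e.right_inv hy] at this

theorem exists_isCrossBox_chart {e : OpenPartialHomeomorph S2 (ℝ × ℝ)} (hpe : p ∈ e.source)
    (hp0 : e p = 0) (he : ∀ q ∈ e.source, q ∈ range L.curve ↔ (e q).1 = 0 ∨ (e q).2 = 0)
    {W : Set S2} (hW : W ∈ 𝓝 p) :
    ∃ r > 0, Metric.ball 0 r ⊆ e.target ∧ e.symm '' Metric.ball 0 r ⊆ W ∧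
      IsCrossBox L.image (e.symm '' Metric.ball 0 r) p (chartQuadrant e r) (chartArm e r) := by
  have h0 : (0 : ℝ × ℝ) ∈ e.target := hp0 ▸ e.map_source hpe
  have hp0' : e.symm 0 = p := by rw [← hp0, e.left_inv hpe]
  have hc := e.continuousOn_symm.continuousAt (e.open_target.mem_nhds h0)
  rw [← hp0'] at hW
  obtain ⟨r, hr, hball⟩ := Metric.mem_nhds_iff.1
    (Filter.inter_mem (hc hW) (e.open_target.mem_nhds h0))
  have hb : Metric.ball 0 r ⊆ e.target := fun z hz => (hball hz).2
  refine ⟨r, hr, hb, ?_, ?_⟩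
  · rintro _ ⟨y, hy, rfl⟩
    exact (hball hy).1
  · rw [← hp0']
    refine isCrossBox_chart hr hb fun y hy => ?_
    have := he (e.symm y) (e.map_target (hb hy))
    rwa [e.right_inv (hb hy)] at this

theorem exists_isCrossBox (hp : p ∈ L.crossings) : ∃ U Q V, IsCrossBox L.image U p Q V := by
  obtain ⟨s, t, -, -, e, hpe, hp0, he, -⟩ := isTransverseDoublePoint hp
  obtain ⟨r, -, -, -, h⟩ := exists_isCrossBox_chart hpe hp0 he univ_mem
  exact ⟨_, _, _, h⟩

theorem not_mem_crossings (hq : IsFlatPoint L.image q) : q ∉ L.crossings := by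
  intro hqc
  obtain ⟨U, Q, V, h⟩ := exists_isCrossBox hqc
  exact h.not_isFlatPoint (L.crossings_subset hqc) hq

theorem _root_.LinkProj.IsCrossBox.arm_notMem_crossings {U : Set S2} {Q V : ZMod 4 → Set S2}
    (h : IsCrossBox L.image U p Q V) {k : ZMod 4} (hq : q ∈ V k) : q ∉ L.crossings :=
  not_mem_crossings (h.flatPoint k q hq)

theorem isFlatPoint (hp : p ∈ L.image) (hpc : p ∉ L.crossings) : IsFlatPoint L.image p :=
  (eventually_isFlatPoint hp hpc).self_of_nhds

variable (L)

/-- Every point of a cross box other than its centre lies in some `V k`, hence is flat, and flat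
points are not crossings. Compactness then makes the crossings finite. -/
theorem eventually_eq_of_mem_crossings (p : S2) : ∀ᶠ q in 𝓝 p, q ∈ L.crossings → q = p := by
  by_cases hpc : p ∈ L.crossings
  · obtain ⟨U, Q, V, h⟩ := exists_isCrossBox hpc
    filter_upwards [h.isOpen.mem_nhds h.mem] with q hq hqc
    rw [h.eq_union] at hq
    rcases hq with hq | hq
    · exact hq
    · obtain ⟨k, hk⟩ := mem_iUnion.1 hq
      exact (h.arm_notMem_crossings hk hqc).elim
  · by_cases hp : p ∈ L.image
    · filter_upwards [eventually_isFlatPoint hp hpc] with q hq hqc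
      exact (not_mem_crossings hq hqc).elim
    · filter_upwards [L.isClosed_image.isOpen_compl.mem_nhds hp] with q hq hqc
      exact (hq (L.crossings_subset hqc)).elim

theorem finite_crossings : L.crossings.Finite := by
  obtain ⟨t, -, ht⟩ := isCompact_univ.elim_nhds_subcover _
    fun p _ => L.eventually_eq_of_mem_crossings p
  refine t.finite_toSet.subset fun q hq => ?_
  obtain ⟨p, hpt, hp⟩ := mem_iUnion₂.1 (ht (mem_univ q))
  have : q = p := hp hq
  exact this ▸ hpt

theorem dense_compl_image : Dense L.imageᶜ := by
  intro p
  by_cases hp : p ∈ L.image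
  · by_cases hpc : p ∈ L.crossings
    · obtain ⟨U, Q, V, h⟩ := exists_isCrossBox hpc
      exact closure_mono (fun x hx => (h.quadrant_subset 0 hx).2) (h.mem_closure 0)
    · obtain ⟨U, A, B, hpU, -, h⟩ := isFlatPoint hp hpc univ univ_mem
      exact closure_mono (fun x hx => (h.left_subset hx).2) (h.subset_left ⟨hpU, hp⟩)
  · exact subset_closure hp

/-- The region that contains `x`. -/
def regionOf (x : S2) : Set S2 := connectedComponentIn L.imageᶜ x

variable {L} {x y : S2} {R : Set S2}

theorem regionOf_mem_regions (hx : x ∉ L.image) : L.regionOf x ∈ L.regions := ⟨x, hx, rfl⟩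

theorem mem_regionOf (hx : x ∉ L.image) : x ∈ L.regionOf x := mem_connectedComponentIn hx

theorem regionOf_eq_of_mem (hR : R ∈ L.regions) (hx : x ∈ R) : L.regionOf x = R := by
  obtain ⟨y, -, rfl⟩ := hR
  exact (connectedComponentIn_eq hx).symm

theorem subset_compl_image (hR : R ∈ L.regions) : R ⊆ L.imageᶜ := by
  obtain ⟨y, -, rfl⟩ := hR
  exact connectedComponentIn_subset _ _

theorem isOpen_region (hR : R ∈ L.regions) : IsOpen R := by
  obtain ⟨y, -, rfl⟩ := hR
  exact L.isClosed_image.isOpen_compl.connectedComponentIn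

theorem isPreconnected_region (hR : R ∈ L.regions) : IsPreconnected R := by
  obtain ⟨y, -, rfl⟩ := hR
  exact isPreconnected_connectedComponentIn

theorem region_nonempty (hR : R ∈ L.regions) : R.Nonempty := by
  obtain ⟨y, hy, rfl⟩ := hR
  exact ⟨y, mem_connectedComponentIn hy⟩

theorem subset_regionOf {T : Set S2} (hT : IsPreconnected T) (hTL : T ⊆ L.imageᶜ) (hx : x ∈ T) :
    T ⊆ L.regionOf x := hT.subset_connectedComponentIn hx hTL

theorem regionOf_eq {T : Set S2} (hT : IsPreconnected T) (hTL : T ⊆ L.imageᶜ) (hx : x ∈ T)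
    (hy : y ∈ T) : L.regionOf x = L.regionOf y :=
  connectedComponentIn_eq (subset_regionOf hT hTL hx hy)

theorem mem_frontier_iff (hR : R ∈ L.regions) (hq : q ∈ L.image) :
    q ∈ frontier R ↔ q ∈ closure R := by
  rw [(isOpen_region hR).frontier_eq]
  exact and_iff_left fun h => subset_compl_image hR h hq

theorem frontier_subset_image (hR : R ∈ L.regions) : frontier R ⊆ L.image := by
  intro q hq
  by_contra hqL
  have hq' := regionOf_mem_regions hqL
  obtain ⟨z, hz1, hz2⟩ := mem_closure_iff.1 (frontier_subset_closure hq) _ (isOpen_region hq')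
    (mem_regionOf hqL)
  have : L.regionOf q = R := (regionOf_eq_of_mem hq' hz1).symm.trans (regionOf_eq_of_mem hR hz2)
  rw [(isOpen_region hR).frontier_eq] at hq
  exact hq.2 (this ▸ mem_regionOf hqL)

/-- The regions that have `q` on their boundary. -/
def sides (L : LinkProjection) (q : S2) : Set (Set S2) := {R ∈ L.regions | q ∈ frontier R}

/-- A region with `q` on its boundary meets the box, hence contains one of its two connected sides.
-/
theorem _root_.LinkProj.IsFlatBox.sides_eq {U A B : Set S2} (h : IsFlatBox L.image U A B)
    (hq : q ∈ U ∩ L.image) (hx : x ∈ A) (hy : y ∈ B) :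
    L.sides q = {L.regionOf x, L.regionOf y} := by
  have hA : A ⊆ L.imageᶜ := fun z hz => (h.left_subset hz).2
  have hB : B ⊆ L.imageᶜ := fun z hz => (h.right_subset hz).2
  ext R
  constructor
  · rintro ⟨hR, hqR⟩
    rw [mem_frontier_iff hR hq.2] at hqR
    obtain ⟨z, hzU, hzR⟩ := mem_closure_iff.1 hqR U h.isOpen hq.1
    have : z ∈ A ∪ B := h.union_eq ▸ ⟨hzU, subset_compl_image hR hzR⟩
    rw [← regionOf_eq_of_mem hR hzR]
    rcases this with hz | hz
    · exact .inl (regionOf_eq h.isPreconnected_left hA hz hx)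
    · exact .inr (regionOf_eq h.isPreconnected_right hB hz hy)
  · rintro (rfl | rfl)
    · refine ⟨regionOf_mem_regions (hA hx), ?_⟩
      rw [mem_frontier_iff (regionOf_mem_regions (hA hx)) hq.2]
      exact closure_mono (subset_regionOf h.isPreconnected_left hA hx) (h.subset_left hq)
    · refine ⟨regionOf_mem_regions (hB hy), ?_⟩
      rw [mem_frontier_iff (regionOf_mem_regions (hB hy)) hq.2]
      exact closure_mono (subset_regionOf h.isPreconnected_right hB hy) (h.subset_right hq)

theorem _root_.LinkProj.IsCrossBox.sides_eq {U : Set S2} {Q V : ZMod 4 → Set S2}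
    (h : IsCrossBox L.image U p Q V) (hp : p ∈ L.image) {x : ZMod 4 → S2} (hx : ∀ k, x k ∈ Q k) :
    L.sides p = range fun k => L.regionOf (x k) := by
  have hQ : ∀ k, Q k ⊆ L.imageᶜ := fun k z hz => (h.quadrant_subset k hz).2
  have hQc : ∀ k, IsPreconnected (Q k) := fun k => (h.flat k).isPreconnected_left
  ext R
  constructor
  · rintro ⟨hR, hqR⟩
    rw [mem_frontier_iff hR hp] at hqR
    obtain ⟨z, hzU, hzR⟩ := mem_closure_iff.1 hqR U h.isOpen h.mem
    obtain ⟨k, hk⟩ := mem_iUnion.1 (h.diff_subset hp ⟨hzU, subset_compl_image hR hzR⟩)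
    rw [← regionOf_eq_of_mem hR hzR]
    exact ⟨k, regionOf_eq (hQc k) (hQ k) (hx k) hk⟩
  · rintro ⟨k, rfl⟩
    have hreg := regionOf_mem_regions (hQ k (hx k))
    refine ⟨hreg, ?_⟩
    rw [mem_frontier_iff hreg hp]
    exact closure_mono (subset_regionOf (hQc k) (hQ k) (hx k)) (h.mem_closure k)

end LinkProjection

/-! ### Marked circles and their edges -/

/-- Moving along a disjoint union of circles. -/
noncomputable def rot {ι : Type*} (θ : ℝ) (x : ι × Circle) : ι × Circle :=
  (x.1, x.2 * Circle.exp θ)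

section Rot

variable {ι : Type*} {P : Set (ι × Circle)} {x y z : ι × Circle} {θ : ℝ}

theorem rot_rot (θ θ' : ℝ) (x : ι × Circle) : rot θ (rot θ' x) = rot (θ + θ') x := by
  simp only [rot, mul_assoc, ← Circle.exp_add, add_comm]

@[simp] theorem rot_zero (x : ι × Circle) : rot 0 x = x := by simp [rot]

theorem rot_neg_rot (θ : ℝ) (x : ι × Circle) : rot (-θ) (rot θ x) = x := by simp [rot_rot]

/-- A finite set of points that meets each of the circles. -/
structure IsMarking (P : Set (ι × Circle)) : Prop where
  finite : P.Finite
  meets : ∀ i, ∃ z ∈ P, z.1 = i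

/-- The time of the first visit to `P`, at a positive time. -/
noncomputable def firstTime (P : Set (ι × Circle)) (x : ι × Circle) : ℝ :=
  sInf {θ | 0 < θ ∧ rot θ x ∈ P}

/-- The first point of `P` after `x`. -/
noncomputable def nextMark (P : Set (ι × Circle)) (x : ι × Circle) : ι × Circle :=
  rot (firstTime P x) x

theorem firstTime_eq (hθ : 0 < θ) (hθP : rot θ x ∈ P) (h : ∀ t, 0 < t → t < θ → rot t x ∉ P) :
    firstTime P x = θ := by
  apply le_antisymm
  · exact csInf_le ⟨0, fun t ht => ht.1.le⟩ ⟨hθ, hθP⟩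
  · exact le_csInf ⟨θ, hθ, hθP⟩ fun t ht => not_lt.1 fun htθ => h t ht.1 htθ ht.2

theorem IsMarking.exists_first (hP : IsMarking P) (x : ι × Circle) :
    ∃ θ, 0 < θ ∧ rot θ x ∈ P ∧ ∀ t, 0 < t → t < θ → rot t x ∉ P := by
  -- One period suffices. The interval is open at 0 and closed at `2π`, so that a circle with the
  -- single mark `x` returns to it at time `2π`.
  let T : Set ℝ := {θ | θ ∈ Ioc 0 (2 * Real.pi) ∧ rot θ x ∈ P}
  have hT : T.Finite := by
    refine Set.Finite.of_finite_image (f := fun θ => rot θ x) (hP.finite.subset ?_) ?_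
    · rintro _ ⟨θ, hθ, rfl⟩
      exact hθ.2
    · intro a ha b hb hab
      refine Circle.exp_injOn_Ioc (a := 0) (b := 2 * Real.pi) (by simp) ha.1 hb.1 ?_
      exact mul_left_cancel (congrArg Prod.snd hab)
  have hne : T.Nonempty := by
    obtain ⟨z, hz, hzx⟩ := hP.meets x.1
    obtain ⟨a, ha⟩ := Circle.exp_surjective (x.2⁻¹ * z.2)
    have hper : Circle.exp (toIocMod Real.two_pi_pos 0 a) = Circle.exp a := by
      rw [toIocMod, zsmul_eq_mul, Circle.exp_eq_exp]
      exact ⟨-toIocDiv Real.two_pi_pos 0 a, by push_cast; ring⟩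
    refine ⟨toIocMod Real.two_pi_pos 0 a, by simpa using toIocMod_mem_Ioc Real.two_pi_pos 0 a, ?_⟩
    have : rot (toIocMod Real.two_pi_pos 0 a) x = z := by
      refine Prod.ext hzx.symm ?_
      simp [rot, hper, ha]
    rwa [this]
  obtain ⟨θ, hθ, hmin⟩ := Set.exists_min_image T id hT hne
  refine ⟨θ, hθ.1.1, hθ.2, fun t ht htθ htP => ?_⟩
  exact absurd (hmin t ⟨⟨ht, htθ.le.trans hθ.1.2⟩, htP⟩) (not_le.2 htθ)

theorem IsMarking.firstTime_pos (hP : IsMarking P) (x : ι × Circle) : 0 < firstTime P x := by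
  obtain ⟨θ, h1, h2, h3⟩ := hP.exists_first x
  rwa [firstTime_eq h1 h2 h3]

theorem IsMarking.nextMark_mem (hP : IsMarking P) (x : ι × Circle) : nextMark P x ∈ P := by
  obtain ⟨θ, h1, h2, h3⟩ := hP.exists_first x
  rwa [nextMark, firstTime_eq h1 h2 h3]

theorem IsMarking.rot_notMem (hP : IsMarking P) (h0 : 0 < θ) (h : θ < firstTime P x) :
    rot θ x ∉ P := by
  obtain ⟨θ', h1, h2, h3⟩ := hP.exists_first x
  rw [firstTime_eq h1 h2 h3] at h
  exact h3 θ h0 h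

theorem IsMarking.nextMark_rot (hP : IsMarking P) (h0 : 0 ≤ θ) (h : θ < firstTime P x) :
    nextMark P (rot θ x) = nextMark P x := by
  have : firstTime P (rot θ x) = firstTime P x - θ := by
    refine firstTime_eq (sub_pos.2 h) ?_ fun t ht htθ => ?_
    · rw [rot_rot, sub_add_cancel]
      exact hP.nextMark_mem x
    · rw [rot_rot]
      exact hP.rot_notMem (by linarith) (by linarith)
  rw [nextMark, this, rot_rot, sub_add_cancel, nextMark]

/-- Running back from the common mark, the nearer point `x` is met on the way to `y`. -/
theorem IsMarking.exists_rot_of_nextMark_eq (hP : IsMarking P) (h : nextMark P x = nextMark P y)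
    (hle : firstTime P x ≤ firstTime P y) :
    ∃ θ, 0 ≤ θ ∧ θ < firstTime P y ∧ x = rot θ y := by
  refine ⟨firstTime P y - firstTime P x, by linarith, by linarith [hP.firstTime_pos x], ?_⟩
  rw [nextMark, nextMark] at h
  have := rot_neg_rot (firstTime P x) x
  rw [h, rot_rot] at this
  rw [sub_eq_neg_add]
  exact this.symm

/-- If two marks had the same successor, the nearer one would be a mark passed before the first one.
As `P` is finite, `nextMark` will therefore be a permutation of the marks. -/
theorem IsMarking.nextMark_injOn (hP : IsMarking P) : InjOn (nextMark P) P := by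
  have key : ∀ x ∈ P, ∀ y, nextMark P x = nextMark P y → firstTime P x ≤ firstTime P y →
      x = y := by
    intro x hx y h hle
    obtain ⟨θ, h0, h1, rfl⟩ := hP.exists_rot_of_nextMark_eq h hle
    rcases h0.eq_or_lt with rfl | h0
    · exact rot_zero y
    · exact (hP.rot_notMem h0 h1 hx).elim
  intro x hx y hy h
  rcases le_total (firstTime P x) (firstTime P y) with hle | hle
  · exact key x hx y h hle
  · exact (key y hy x h.symm hle).symm

variable [TopologicalSpace ι]

theorem continuous_rot (x : ι × Circle) : Continuous fun θ => rot θ x := by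
  unfold rot
  fun_prop

theorem tendsto_rot (x : ι × Circle) : Tendsto (fun θ => rot θ x) (𝓝 0) (𝓝 x) := by
  simpa using (continuous_rot x).tendsto 0

/-- Since `Circle.exp` is a local homeomorphism, statements about nearby parameters become
statements about small angles. -/
theorem nhds_eq_map_rot [DiscreteTopology ι] (x : ι × Circle) :
    𝓝 x = map (fun θ => rot θ x) (𝓝 0) := by
  have h1 : 𝓝 x.2 = map (fun θ => x.2 * Circle.exp θ) (𝓝 0) := by
    have h := isLocalHomeomorph_circleExp.map_nhds_eq 0
    rw [Circle.exp_zero] at h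
    have h2 := (Homeomorph.mulLeft x.2).map_nhds_eq 1
    rw [← h, map_map] at h2
    simpa [Function.comp_def] using h2.symm
  obtain ⟨i, u⟩ := x
  rw [nhds_prod_eq, nhds_discrete, h1]
  simp only [rot]
  rw [pure_prod, map_map]
  rfl

theorem IsMarking.eventually_rot_notMem [T1Space ι] (hP : IsMarking P) (x : ι × Circle) :
    ∀ᶠ θ in 𝓝[≠] (0 : ℝ), rot θ x ∉ P := by
  have h1 : ∀ᶠ y in 𝓝 x, y ∉ P \ {x} :=
    (hP.finite.subset sdiff_subset).isClosed.isOpen_compl.mem_nhds fun h => h.2 rfl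
  have h2 := (tendsto_rot x).eventually h1
  have h3 : ∀ᶠ θ in 𝓝 (0 : ℝ), θ ∈ Ioo (-Real.pi) Real.pi :=
    Ioo_mem_nhds (by linarith [Real.pi_pos]) Real.pi_pos
  filter_upwards [nhdsWithin_le_nhds h2, nhdsWithin_le_nhds h3, self_mem_nhdsWithin]
    with θ h4 h5 h6 h7
  refine h4 ⟨h7, fun h => h6 ?_⟩
  have h8 : x.2 * Circle.exp θ = x.2 := congrArg Prod.snd h
  rw [mul_eq_left, ← Circle.exp_zero] at h8
  refine Circle.exp_injOn_Ioc (a := -Real.pi) (b := Real.pi) (by linarith) ⟨h5.1, h5.2.le⟩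
    ⟨by linarith [Real.pi_pos], Real.pi_pos.le⟩ h8

theorem IsMarking.exists_rot_notMem [T1Space ι] (hP : IsMarking P) (x : ι × Circle) :
    ∃ ε > 0, ∀ θ, θ ≠ 0 → |θ| < ε → rot θ x ∉ P := by
  obtain ⟨ε, hε, h⟩ := Metric.eventually_nhds_iff.1
    (eventually_nhdsWithin_iff.1 (hP.eventually_rot_notMem x))
  exact ⟨ε, hε, fun θ h0 hθ => h (by simpa using hθ) h0⟩

/-- Shortly before a marked point this is the next one; shortly after it the next one is that
following it. -/
theorem IsMarking.exists_nextMark_rot [T1Space ι] (hP : IsMarking P) (hz : z ∈ P) :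
    ∃ ε > 0, ∀ θ, |θ| < ε → θ ≠ 0 → rot θ z ∉ P ∧ (θ < 0 → nextMark P (rot θ z) = z) ∧
      (0 < θ → nextMark P (rot θ z) = nextMark P z) := by
  obtain ⟨ε, hε, h⟩ := hP.exists_rot_notMem z
  refine ⟨min ε (firstTime P z), lt_min hε (hP.firstTime_pos z), fun θ hθ h0 =>
    ⟨h θ h0 (hθ.trans_le (min_le_left _ _)), fun hneg => ?_, fun hpos => ?_⟩⟩
  · have : firstTime P (rot θ z) = -θ := by
      refine firstTime_eq (neg_pos.2 hneg) (by rwa [rot_neg_rot]) fun t ht htθ => ?_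
      rw [rot_rot]
      refine h _ (by linarith) ?_
      have := hθ.trans_le (min_le_left _ _)
      rw [abs_lt] at this ⊢
      constructor <;> linarith
    rw [nextMark, this, rot_neg_rot]
  · exact hP.nextMark_rot hpos.le ((le_abs_self θ).trans_lt (hθ.trans_le (min_le_right _ _)))

theorem IsMarking.eventually_nextMark_eq [DiscreteTopology ι] (hP : IsMarking P) (hx : x ∉ P) :
    ∀ᶠ y in 𝓝 x, y ∉ P ∧ nextMark P y = nextMark P x := by
  obtain ⟨ε, hε, h⟩ := hP.exists_rot_notMem x
  have h' : ∀ θ, |θ| < ε → rot θ x ∉ P := fun θ hθ => by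
    rcases eq_or_ne θ 0 with rfl | h0
    · rwa [rot_zero]
    · exact h θ h0 hθ
  rw [nhds_eq_map_rot, eventually_map]
  have : ∀ᶠ θ in 𝓝 (0 : ℝ), |θ| < min ε (firstTime P x) :=
    (continuous_abs.tendsto' 0 0 abs_zero).eventually
      (gt_mem_nhds (lt_min hε (hP.firstTime_pos x)))
  filter_upwards [this] with θ hθ
  refine ⟨h' θ (hθ.trans_le (min_le_left _ _)), ?_⟩
  rcases le_or_gt 0 θ with h0 | h0
  · exact hP.nextMark_rot h0 ((le_abs_self θ).trans_lt (hθ.trans_le (min_le_right _ _)))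
  -- For `θ < 0` the point `x` comes after `rot θ x`; a mark met between them would lie within `ε`
  -- of `x`.
  · have hlt : -θ < firstTime P (rot θ x) := by
      by_contra! hle
      refine h' (firstTime P (rot θ x) + θ) ?_ ?_
      · have h1 := hθ.trans_le (min_le_left _ _)
        have h2 := hP.firstTime_pos (rot θ x)
        rw [abs_lt] at h1 ⊢
        constructor <;> linarith
      · rw [← rot_rot]
        exact hP.nextMark_mem _
    have := hP.nextMark_rot (by linarith) hlt
    rw [rot_neg_rot] at this
    exact this.symm

/-- A function that is locally constant off the marked points takes the same value at points that
are followed by the same marked point. -/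
theorem IsMarking.eq_of_nextMark_eq [DiscreteTopology ι] {α : Type*} (hP : IsMarking P)
    {f : ι × Circle → α} (hf : ∀ x ∉ P, ∀ᶠ y in 𝓝 x, f y = f x) (hx : x ∉ P) (hy : y ∉ P)
    (h : nextMark P x = nextMark P y) : f x = f y := by
  have key : ∀ x ∉ P, ∀ y ∉ P, nextMark P x = nextMark P y → firstTime P x ≤ firstTime P y →
      f x = f y := by
    intro x hx y hy h hle
    obtain ⟨θ, h0, h1, rfl⟩ := hP.exists_rot_of_nextMark_eq h hle
    have hI : ∀ t ∈ Ico 0 (firstTime P y), rot t y ∉ P := by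
      intro t ht
      rcases ht.1.eq_or_lt with rfl | h0
      · rwa [rot_zero]
      · exact hP.rot_notMem h0 ht.2
    have := isPreconnected_Ico.induction₂' (s := Ico 0 (firstTime P y))
      (fun s t => f (rot s y) = f (rot t y)) (fun t ht => ?_)
      (fun _ _ _ _ _ _ h1 h2 => h1.trans h2) ⟨h0, h1⟩ ⟨le_rfl, hP.firstTime_pos y⟩
    · simpa using this
    · have hc := (continuous_rot y).tendsto t
      filter_upwards [nhdsWithin_le_nhds (hc.eventually (hf _ (hI t ht)))] with s hs
      exact ⟨hs.symm, hs⟩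
  rcases le_total (firstTime P x) (firstTime P y) with hle | hle
  · exact key x hx y hy h hle
  · exact (key y hy x hx h.symm hle).symm

end Rot

/-! ### Passing through a crossing -/

theorem pos_or_neg_of_isPreconnected {s : Set ℝ} (hs : IsPreconnected s) {g : ℝ → ℝ}
    (hg : ContinuousOn g s) (h0 : ∀ x ∈ s, g x ≠ 0) :
    (∀ x ∈ s, 0 < g x) ∨ ∀ x ∈ s, g x < 0 := by
  by_contra! h
  obtain ⟨⟨x, hx, hx0⟩, y, hy, hy0⟩ := h
  obtain ⟨z, hz, hz0⟩ := hs.intermediate_value hx hy hg ⟨hx0, hy0⟩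
  exact h0 z hz hz0

theorem eq_zero_of_armForm {k : ZMod 4} {y : ℝ × ℝ} (h : armForm k y = 0)
    (h' : armForm (k + 1) y = 0) : y = 0 := by
  by_contra hy
  obtain ⟨l, hl⟩ := exists_armForm_pos_of_ne_zero hy
  have h2 := armForm_add_two k y
  have h3 := armForm_add_two (k + 1) y
  rcases (by decide : ∀ k l : ZMod 4, l = k ∨ l = k + 1 ∨ l = k + 2 ∨ l = k + 1 + 2) k l with
    rfl | rfl | rfl | rfl <;> linarith

namespace LinkProjection

variable (L : LinkProjection)

/-- The parameters at which the curve passes through a crossing. -/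
def marks : Set (Fin L.components × Circle) := L.curve ⁻¹' L.crossings

variable {L} {p : S2}

/-- A continuous map from a compact space to a Hausdorff space is closed, so all parameters of
points near `p` lie near parameters of `p`. -/
theorem eventually_fiber {T : Fin L.components × Circle → Prop}
    (h : ∀ x, L.curve x = p → ∀ᶠ y in 𝓝 x, T y) : ∀ᶠ q in 𝓝 p, ∀ x, L.curve x = q → T x :=
  L.continuous_curve.isClosedMap.eventually_nhds_fiber p h

/-- This is where connectedness enters: a circle without marks meets no other circle and would split
off. Crossings exist, so the other class of components is nonempty. -/
theorem isMarking_marks (hconn : L.Connected) (hne : L.crossings.Nonempty) :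
    IsMarking L.marks := by
  constructor
  · refine L.finite_crossings.preimage' fun p hp => ?_
    obtain ⟨s, t, -, h, -⟩ := isTransverseDoublePoint hp
    rw [h]
    exact toFinite _
  · by_contra! h
    obtain ⟨i, hi⟩ := h
    refine hconn ⟨{i}, singleton_nonempty i, ?_, ?_⟩
    · obtain ⟨p, s, t, hst, hs, ht⟩ := hne
      refine ⟨s.1, fun hsi => hi s ⟨s, t, hst, rfl, ht.trans hs.symm⟩ hsi⟩
    · rw [disjoint_left]
      rintro _ ⟨x, hx, rfl⟩ ⟨y, hy, hxy⟩
      refine hi x ⟨x, y, ?_, rfl, hxy⟩ hx.1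
      rintro rfl
      exact hy.1 hx.1

/-- The passage through a crossing along one of its two branches. -/
theorem exists_branch (hM : IsMarking L.marks) {e : OpenPartialHomeomorph S2 (ℝ × ℝ)}
    (hpe : p ∈ e.source) (hp0 : e p = 0) (hp : p ∈ L.crossings)
    (he : ∀ q ∈ e.source, q ∈ range L.curve ↔ (e q).1 = 0 ∨ (e q).2 = 0)
    {z z' : Fin L.components × Circle} (hzz : z ≠ z') (hz : L.curve z = p)
    (hfib : ∀ x, L.curve x = p → x = z ∨ x = z') {k : ZMod 4}
    (hk : ∀ᶠ x in 𝓝 z, armForm (k + 1) (e (L.curve x)) = 0)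
    (hk' : ∀ᶠ x in 𝓝 z', armForm k (e (L.curve x)) = 0) :
    ∃ a b, ((a = z ∧ b = nextMark L.marks z) ∨ (a = nextMark L.marks z ∧ b = z)) ∧
      ∀ᶠ x in 𝓝 z, (0 < armForm k (e (L.curve x)) → nextMark L.marks x = a) ∧
        (armForm k (e (L.curve x)) < 0 → nextMark L.marks x = b) := by
  have hzM : z ∈ L.marks := by rw [marks, mem_preimage, hz]; exact hp
  have hsrc : ∀ᶠ x in 𝓝 z, L.curve x ∈ e.source :=
    L.continuous_curve.continuousAt.eventually (e.open_source.mem_nhds (hz ▸ hpe))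
  have hne : ∀ᶠ x in 𝓝 z, x ≠ z' := isOpen_ne.mem_nhds hzz
  have hgood : ∀ᶠ θ in 𝓝 (0 : ℝ), L.curve (rot θ z) ∈ e.source ∧ rot θ z ≠ z' ∧
      armForm (k + 1) (e (L.curve (rot θ z))) = 0 :=
    (tendsto_rot z).eventually (hsrc.and (hne.and hk))
  obtain ⟨ε₁, hε₁, h1⟩ := Metric.eventually_nhds_iff.1 hgood
  obtain ⟨ε₂, hε₂, h2⟩ := hM.exists_nextMark_rot hzM
  obtain ⟨ε, hε, hε1, hε2⟩ : ∃ ε > 0, ε ≤ ε₁ ∧ ε ≤ ε₂ :=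
    ⟨min ε₁ ε₂, lt_min hε₁ hε₂, min_le_left _ _, min_le_right _ _⟩
  let g : ℝ → ℝ := fun θ => armForm k (e (L.curve (rot θ z)))
  have h1' : ∀ θ, |θ| < ε → L.curve (rot θ z) ∈ e.source ∧ rot θ z ≠ z' ∧
      armForm (k + 1) (e (L.curve (rot θ z))) = 0 := fun θ hθ =>
    h1 (by simpa using hθ.trans_le hε1)
  have hg0 : ∀ θ, |θ| < ε → θ ≠ 0 → g θ ≠ 0 := by
    intro θ hθ h0 hg
    have h3 := eq_zero_of_armForm hg (h1' θ hθ).2.2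
    have h4 : L.curve (rot θ z) = p := e.injOn (h1' θ hθ).1 hpe (h3.trans hp0.symm)
    have h5 := (hfib _ h4).resolve_right (h1' θ hθ).2.1
    exact (h2 θ (hθ.trans_le hε2) h0).1 (by rw [h5]; exact hzM)
  have hgc : ContinuousOn g {θ | |θ| < ε} := by
    intro θ hθ
    refine ContinuousAt.continuousWithinAt ?_
    refine (armForm k).continuous.continuousAt.comp ?_
    exact ContinuousAt.comp (f := fun θ => L.curve (rot θ z)) (e.continuousAt (h1' θ hθ).1)
      (L.continuous_curve.comp (continuous_rot z)).continuousAt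
  have hposI : ∀ θ ∈ Ioo 0 ε, |θ| < ε ∧ θ ≠ 0 := fun θ hθ =>
    ⟨abs_lt.2 ⟨by linarith [hθ.1], hθ.2⟩, hθ.1.ne'⟩
  have hnegI : ∀ θ ∈ Ioo (-ε) 0, |θ| < ε ∧ θ ≠ 0 := fun θ hθ =>
    ⟨abs_lt.2 ⟨hθ.1, by linarith [hθ.2]⟩, hθ.2.ne⟩
  -- Since `g` vanishes only at `θ = 0`, the branch stays on one arm before the passage and on one
  -- arm after it.
  have hpos := pos_or_neg_of_isPreconnected isPreconnected_Ioo
    (hgc.mono fun θ hθ => (hposI θ hθ).1) fun θ hθ => hg0 θ (hposI θ hθ).1 (hposI θ hθ).2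
  have hneg := pos_or_neg_of_isPreconnected isPreconnected_Ioo
    (hgc.mono fun θ hθ => (hnegI θ hθ).1) fun θ hθ => hg0 θ (hnegI θ hθ).1 (hnegI θ hθ).2
  have hnhds : ∀ {T : Fin L.components × Circle → Prop}, (∀ θ, |θ| < ε → T (rot θ z)) →
      ∀ᶠ x in 𝓝 z, T x := by
    intro T hT
    rw [nhds_eq_map_rot, eventually_map]
    filter_upwards [(continuous_abs.tendsto' 0 0 abs_zero).eventually (gt_mem_nhds hε)] with θ hθ
    exact hT θ hθ
  have hg00 : g 0 = 0 := by simp [g, hz, hp0]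
  -- the curve runs through both arms
  have hboth : ∀ s : ℝ, s ≠ 0 → ¬ ∀ θ, |θ| < ε → 0 ≤ s * g θ := by
    intro s hs hsg
    -- If the branch avoided one arm, no point near `p` on that arm would be in the image, as the
    -- other branch runs in the other axis. The chart says the whole cross is in the image; points
    -- `(t * -s) • v` give the contradiction.
    have hev : ∀ᶠ q in 𝓝 p, ∀ x, L.curve x = q → 0 ≤ s * armForm k (e (L.curve x)) := by
      refine eventually_fiber fun x hx => ?_
      rcases hfib x hx with rfl | rfl
      · exact hnhds hsg
      · exact hk'.mono fun y hy => by rw [hy, mul_zero]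
    obtain ⟨v, hv1, hv2⟩ := exists_armForm_eq_one (k + 1)
    rw [add_sub_cancel_right] at hv2
    have hc : ContinuousAt (fun t : ℝ => e.symm ((t * -s) • v)) 0 := by
      refine ContinuousAt.comp (g := e.symm) ?_ (by fun_prop)
      rw [zero_mul, zero_smul, ← hp0]
      exact e.symm.continuousAt (e.map_source hpe)
    have hc0 : e.symm (((0 : ℝ) * -s) • v) = p := by
      rw [zero_mul, zero_smul, ← hp0, e.left_inv hpe]
    have ht : ∀ᶠ t in 𝓝 (0 : ℝ), (t * -s) • v ∈ e.target := by
      have : Continuous fun t : ℝ => (t * -s) • v := by fun_prop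
      refine this.continuousAt.eventually (e.open_target.mem_nhds ?_)
      change ((0 : ℝ) * -s) • v ∈ e.target
      rw [zero_mul, zero_smul, ← hp0]
      exact e.map_source hpe
    have hev' := hc.eventually (hc0.symm ▸ hev)
    have hev'' := (hev'.and ht).filter_mono (nhdsWithin_le_nhds (s := Ioi 0))
    obtain ⟨t, ⟨ht1, ht2⟩, ht0⟩ := (hev''.and self_mem_nhdsWithin).exists
    have hinv := e.right_inv ht2
    obtain ⟨x, hx⟩ : e.symm ((t * -s) • v) ∈ range L.curve := by
      refine (he _ (e.map_target ht2)).2 ?_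
      rw [hinv, cross_iff (k + 1)]
      left
      simp [hv1]
    have h3 := ht1 x hx
    rw [hx, hinv, map_smul, hv2, smul_eq_mul] at h3
    have h4 : 0 < t * (s * s) := mul_pos ht0 (mul_self_pos.2 hs)
    linarith
  have hcases : ∀ {T : ℝ → Prop}, (∀ θ ∈ Ioo 0 ε, T θ) → (∀ θ ∈ Ioo (-ε) 0, T θ) → T 0 →
      ∀ θ, |θ| < ε → T θ := by
    intro T hT1 hT2 hT0 θ hθ
    rw [abs_lt] at hθ
    rcases lt_trichotomy θ 0 with h | rfl | h
    · exact hT2 θ ⟨hθ.1, h⟩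
    · exact hT0
    · exact hT1 θ ⟨h, hθ.2⟩
  have hN1 : ∀ θ ∈ Ioo 0 ε, nextMark L.marks (rot θ z) = nextMark L.marks z := fun θ hθ =>
    (h2 θ ((hposI θ hθ).1.trans_le hε2) hθ.1.ne').2.2 hθ.1
  have hN2 : ∀ θ ∈ Ioo (-ε) 0, nextMark L.marks (rot θ z) = z := fun θ hθ =>
    (h2 θ ((hnegI θ hθ).1.trans_le hε2) hθ.2.ne).2.1 hθ.2
  have hfin : ∀ {a b}, (∀ θ, |θ| < ε → (0 < g θ → nextMark L.marks (rot θ z) = a) ∧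
      (g θ < 0 → nextMark L.marks (rot θ z) = b)) →
      ∀ᶠ x in 𝓝 z, (0 < armForm k (e (L.curve x)) → nextMark L.marks x = a) ∧
        (armForm k (e (L.curve x)) < 0 → nextMark L.marks x = b) := fun h => hnhds h
  rcases hpos with hpos | hpos <;> rcases hneg with hneg | hneg
  · refine (hboth 1 one_ne_zero (hcases ?_ ?_ ?_)).elim
    · exact fun θ hθ => by rw [one_mul]; exact (hpos θ hθ).le
    · exact fun θ hθ => by rw [one_mul]; exact (hneg θ hθ).le
    · rw [hg00, mul_zero]
  · refine ⟨nextMark L.marks z, z, .inr ⟨rfl, rfl⟩, hfin (hcases ?_ ?_ ?_)⟩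
    · exact fun θ hθ => ⟨fun _ => hN1 θ hθ, fun h => (lt_asymm h (hpos θ hθ)).elim⟩
    · exact fun θ hθ => ⟨fun h => (lt_asymm h (hneg θ hθ)).elim, fun _ => hN2 θ hθ⟩
    · exact ⟨fun h => (h.ne' hg00).elim, fun h => (h.ne hg00).elim⟩
  · refine ⟨z, nextMark L.marks z, .inl ⟨rfl, rfl⟩, hfin (hcases ?_ ?_ ?_)⟩
    · exact fun θ hθ => ⟨fun h => (lt_asymm h (hpos θ hθ)).elim, fun _ => hN1 θ hθ⟩
    · exact fun θ hθ => ⟨fun _ => hN2 θ hθ, fun h => (lt_asymm h (hneg θ hθ)).elim⟩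
    · exact ⟨fun h => (h.ne' hg00).elim, fun h => (h.ne hg00).elim⟩
  · refine (hboth (-1) (by norm_num) (hcases ?_ ?_ ?_)).elim
    · exact fun θ hθ => by linarith [hpos θ hθ]
    · exact fun θ hθ => by linarith [hneg θ hθ]
    · rw [hg00, mul_zero]

/-- The edges that end at a crossing, in the cyclic order of the arms; an edge is represented by
the marked point at its end. -/
theorem exists_crossBox_edges (hM : IsMarking L.marks) (hp : p ∈ L.crossings) :
    ∃ s t U Q V, ∃ ε : ZMod 4 → Fin L.components × Circle, s ≠ t ∧ L.curve ⁻¹' {p} = {s, t} ∧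
      IsCrossBox L.image U p Q V ∧ (∀ k x, L.curve x ∈ V k → nextMark L.marks x = ε k) ∧
      ((ε 0 = s ∧ ε 2 = nextMark L.marks s) ∨ (ε 0 = nextMark L.marks s ∧ ε 2 = s)) ∧
      ((ε 1 = t ∧ ε 3 = nextMark L.marks t) ∨ (ε 1 = nextMark L.marks t ∧ ε 3 = t)) := by
  obtain ⟨s, t, hst, hfib, e, hpe, hp0, he, hs, ht⟩ := isTransverseDoublePoint hp
  have hfib' : ∀ x, L.curve x = p → x = s ∨ x = t := fun x hx => by
    have : x ∈ L.curve ⁻¹' {p} := hx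
    rwa [hfib] at this
  have hsp : L.curve s = p := (hfib ▸ mem_insert s _ : s ∈ L.curve ⁻¹' {p})
  have htp : L.curve t = p := (hfib ▸ mem_insert_of_mem _ rfl : t ∈ L.curve ⁻¹' {p})
  have ht2 : ∀ᶠ x in 𝓝 t, armForm (1 + 1) (e (L.curve x)) = 0 :=
    ht.mono fun x hx => neg_eq_zero.2 hx
  obtain ⟨a, b, hab, h1⟩ := exists_branch hM hpe hp0 hp he (k := 0) hst hsp hfib' hs ht
  obtain ⟨c, d, hcd, h2⟩ := exists_branch hM hpe hp0 hp he (k := 1) hst.symm htp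
    (fun x hx => (hfib' x hx).symm) ht2 hs
  -- Arms 0 and 2 belong to the branch through `s`, arms 1 and 3 to the branch through `t`.
  let ε : ZMod 4 → Fin L.components × Circle := ![a, c, b, d]
  have hev : ∀ᶠ q in 𝓝 p, ∀ x, L.curve x = q →
      ∀ k, 0 < armForm k (e (L.curve x)) → nextMark L.marks x = ε k := by
    refine eventually_fiber fun x hx => ?_
    rcases hfib' x hx with rfl | rfl
    · filter_upwards [h1, hs] with y hy hy' k hk
      fin_cases k
      · exact hy.1 hk
      · exact (hk.ne' hy').elim
      · exact hy.2 (neg_pos.1 hk)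
      · exact ((neg_pos.1 hk).ne hy').elim
    · filter_upwards [h2, ht] with y hy hy' k hk
      fin_cases k
      · exact (hk.ne' hy').elim
      · exact hy.1 hk
      · exact ((neg_pos.1 hk).ne hy').elim
      · exact hy.2 (neg_pos.1 hk)
  obtain ⟨r, hr, hball, hW, hbox⟩ := exists_isCrossBox_chart hpe hp0 he hev
  refine ⟨s, t, _, _, _, ε, hst, hfib, hbox, fun k x hx => ?_, hab, hcd⟩
  have hxU := hW (hbox.arm_subset k hx)
  obtain ⟨y, ⟨hy, hyk⟩, hyx⟩ := hx
  refine hxU x rfl k ?_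
  rw [← hyx, e.right_inv (hball hy)]
  exact hyk

end LinkProjection

/-! ### Counting in an abstract diagram -/

section Combinatorics

open Finset

/-- A proper piece of a permutation that starts at `s` and does not contain `t`. -/
theorem exists_segment {P : Type*} [Finite P] (N : Equiv.Perm P) {s t : P} (hst : s ≠ t) :
    ∃ T : Set P, s ∈ T ∧ t ∉ T ∧ ∀ z, z ≠ s → z ≠ t → (N z ∈ T ↔ z ∈ T) := by
  classical
  -- Follow the orbit of `s` backwards until it first reaches `s` again or `t`; the points before
  -- that form `T`.
  have hex : ∃ m, 0 < m ∧ ((N⁻¹ ^ m) s = s ∨ (N⁻¹ ^ m) s = t) :=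
    ⟨orderOf N⁻¹, orderOf_pos _, .inl (by rw [pow_orderOf_eq_one]; rfl)⟩
  obtain ⟨hm, hm'⟩ := Nat.find_spec hex
  have hmin := fun k (hk : k < Nat.find hex) => Nat.find_min hex hk
  have hN : ∀ k, N ((N⁻¹ ^ (k + 1)) s) = (N⁻¹ ^ k) s := fun k => by
    rw [pow_succ', Equiv.Perm.mul_apply]
    exact N.apply_symm_apply _
  refine ⟨{z | ∃ k < Nat.find hex, (N⁻¹ ^ k) s = z}, ⟨0, hm, rfl⟩, ?_, fun z hzs hzt => ⟨?_, ?_⟩⟩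
  · rintro ⟨k, hk, hkt⟩
    rcases Nat.eq_zero_or_pos k with rfl | h0
    · exact hst hkt
    · exact hmin k hk ⟨h0, .inr hkt⟩
  · rintro ⟨k, hk, hkz⟩
    rw [← hN] at hkz
    have hz := N.injective hkz
    refine ⟨k + 1, lt_of_le_of_ne hk fun h => ?_, hz⟩
    rw [← h, hz] at hm'
    exact hm'.elim hzs hzt
  · rintro ⟨k, hk, hkz⟩
    cases k with
    | zero => exact (hzs hkz.symm).elim
    | succ k => exact ⟨k, by omega, by rw [← hkz, hN]⟩

/-- The combinatorial data of a link projection: crossings `C`, edges `P` (each named by the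
parameter at its end) and regions `F`. The corners and the edges at a crossing are listed
cyclically. -/
structure Diagram (C P F : Type*) [DecidableEq F] where
  corner : C → ZMod 4 → F
  edge : C → ZMod 4 → P
  sides : P → Finset F
  sides_edge : ∀ p k, sides (edge p k) = {corner p k, corner p (k + 1)}
  next : Equiv.Perm P
  base : P → C
  fst : C → P
  snd : C → P
  fst_ne_snd : ∀ p, fst p ≠ snd p
  base_eq_iff : ∀ z p, base z = p ↔ z = fst p ∨ z = snd p
  edge_fst : ∀ p, (edge p 0 = fst p ∧ edge p 2 = next (fst p)) ∨
    (edge p 0 = next (fst p) ∧ edge p 2 = fst p)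
  edge_snd : ∀ p, (edge p 1 = snd p ∧ edge p 3 = next (snd p)) ∨
    (edge p 1 = next (snd p) ∧ edge p 3 = snd p)
  exists_corner : ∀ R, ∃ p k, corner p k = R
  exists_coloring : ∀ w : P → ZMod 2,
    (∀ p, ∑ k, w (edge p k) = 0) → ∃ c : F → ZMod 2, ∀ p k, c (corner p (k + 1)) = c (corner p k) + w (edge p k)
  card_corner_ne : ∀ p, (range (corner p)).encard ≠ 3

namespace Diagram

variable {C P F : Type*} [DecidableEq F] (D : Diagram C P F)

theorem sum_edge_eq {M : Type*} [AddCommMonoid M] (f : P → M) (p : C) :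
    ∑ k, f (D.edge p k) =
      f (D.fst p) + f (D.next (D.fst p)) + (f (D.snd p) + f (D.next (D.snd p))) := by
  have h : ∑ k, f (D.edge p k) =
      (f (D.edge p 0) + f (D.edge p 2)) + (f (D.edge p 1) + f (D.edge p 3)) := by
    rw [show ∑ k, f (D.edge p k) = _ from Fin.sum_univ_four fun k : Fin 4 => f (D.edge p k)]
    change f (D.edge p 0) + f (D.edge p 1) + f (D.edge p 2) + f (D.edge p 3) = _
    rw [add_right_comm (f (D.edge p 0)), add_assoc]
  rw [h]
  rcases D.edge_fst p with ⟨h0, h2⟩ | ⟨h0, h2⟩ <;> rcases D.edge_snd p with ⟨h1, h3⟩ | ⟨h1, h3⟩ <;>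
    rw [h0, h1, h2, h3]
  · rw [add_comm (f (D.next (D.snd p)))]
  · rw [add_comm (f (D.next (D.fst p)))]
  · rw [add_comm (f (D.next (D.snd p))), add_comm (f (D.next (D.fst p)))]

theorem exists_edge_eq (z : P) : ∃ p k, D.edge p k = z := by
  refine ⟨D.base z, ?_⟩
  rcases (D.base_eq_iff z _).1 rfl with h | h
  · rcases D.edge_fst (D.base z) with ⟨h0, -⟩ | ⟨-, h0⟩
    · exact ⟨_, h0.trans h.symm⟩
    · exact ⟨_, h0.trans h.symm⟩
  · rcases D.edge_snd (D.base z) with ⟨h0, -⟩ | ⟨-, h0⟩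
    · exact ⟨_, h0.trans h.symm⟩
    · exact ⟨_, h0.trans h.symm⟩

/-- Checkerboard colouring: the sum of all edges is a cycle because four edge ends meet at each
crossing, so neighbouring corners get different colours. -/
theorem corner_succ_ne (p : C) (k : ZMod 4) : D.corner p (k + 1) ≠ D.corner p k := by
  obtain ⟨c, hc⟩ := D.exists_coloring (fun _ => 1) fun p => by
    rw [Finset.sum_const]; decide
  intro h
  have := hc p k
  rw [h] at this
  exact one_ne_zero (left_eq_add.1 this)

/-- The sum of the values of a function at the four edge ends at a crossing. -/
def boundary : (P → ZMod 2) →ₗ[ZMod 2] (C → ZMod 2) where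
  toFun w p := ∑ k, w (D.edge p k)
  map_add' w w' := by ext p; simp [Finset.sum_add_distrib]
  map_smul' a w := by ext p; simp [Finset.mul_sum]

theorem exists_coloring' {w : P → ZMod 2} (hw : D.boundary w = 0) :
    ∃ c : F → ZMod 2, ∀ p k, c (D.corner p (k + 1)) = c (D.corner p k) + w (D.edge p k) :=
  D.exists_coloring w fun p => congrFun hw p

/-- The crossings on the boundary of a region. -/
def corners [Fintype C] (R : F) : Finset C := univ.filter fun p => ∃ k, D.corner p k = R

/-- The edges on the boundary of a region. -/
def edges [Fintype P] (R : F) : Finset P := univ.filter fun z => R ∈ D.sides z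

/-- The regions that share a crossing with a region. -/
def neighbors [Fintype C] [Fintype F] (R : F) : Finset F :=
  univ.filter fun R' => ∃ p k l, D.corner p k = R ∧ D.corner p l = R'

variable {D} in
theorem mem_corners [Fintype C] {R : F} {p : C} :
    p ∈ D.corners R ↔ ∃ k, D.corner p k = R := by
  simp [corners]

variable {D} in
theorem mem_edges [Fintype P] {R : F} {z : P} : z ∈ D.edges R ↔ R ∈ D.sides z := by
  simp [edges]

variable {D} in
theorem mem_neighbors [Fintype C] [Fintype F] {R R' : F} :
    R' ∈ D.neighbors R ↔ ∃ p k l, D.corner p k = R ∧ D.corner p l = R' := by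
  simp [neighbors]

theorem self_mem_neighbors [Fintype C] [Fintype F] (R : F) : R ∈ D.neighbors R := by
  obtain ⟨p, k, h⟩ := D.exists_corner R
  exact mem_neighbors.2 ⟨p, k, k, h, h⟩

variable [Fintype C] [Fintype P]

theorem sum_marks {M : Type*} [AddCommMonoid M] (g : P → M) :
    ∑ p, (g (D.fst p) + g (D.snd p)) = ∑ z, g z := by
  classical
  rw [← Finset.sum_fiberwise univ D.base g]
  refine Finset.sum_congr rfl fun p _ => ?_
  have : univ.filter (fun z => D.base z = p) = {D.fst p, D.snd p} := by
    ext z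
    simp [D.base_eq_iff]
  rw [this, Finset.sum_pair (D.fst_ne_snd p)]

/-- Every edge has two ends. -/
theorem sum_edge {M : Type*} [AddCommMonoid M] (f : P → M) :
    ∑ p, ∑ k, f (D.edge p k) = 2 • ∑ z, f z := by
  simp only [D.sum_edge_eq]
  rw [D.sum_marks fun z => f z + f (D.next z), Finset.sum_add_distrib,
    Equiv.sum_comp D.next f, two_nsmul]

theorem card_marks (D : Diagram C P F) : Fintype.card P = 2 * Fintype.card C := by
  have := D.sum_marks fun _ => 1
  simp at this
  omega

theorem sum_boundary (w : P → ZMod 2) : ∑ p, D.boundary w p = 0 := by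
  change ∑ p, ∑ k, w (D.edge p k) = 0
  rw [D.sum_edge, two_nsmul]
  exact CharTwo.add_self_eq_zero _

/-- The differences of a function on the regions across the edge ends. -/
def coboundary : (F → ZMod 2) →ₗ[ZMod 2] (C × ZMod 4 → ZMod 2) where
  toFun c x := c (D.corner x.1 (x.2 + 1)) - c (D.corner x.1 x.2)
  map_add' c c' := by ext x; simp; ring
  map_smul' a c := by ext x; simp [mul_sub]

/-- The inequality in Euler's formula that comes from the separation properties of curves. -/
theorem card_add_two_le [Fintype F] [Nonempty C] (D : Diagram C P F) : Fintype.card C + 2 ≤ Fintype.card F := by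
  classical
  have h1 := D.boundary.finrank_range_add_finrank_ker
  have h2 := D.coboundary.finrank_range_add_finrank_ker
  rw [Module.finrank_fintype_fun_eq_card] at h1 h2
  let σ : (C → ZMod 2) →ₗ[ZMod 2] ZMod 2 := ∑ p, LinearMap.proj p
  have hσ : ∀ f, σ f = ∑ p, f p := fun f => by simp [σ]
  have h3 := σ.finrank_range_add_finrank_ker
  rw [Module.finrank_fintype_fun_eq_card] at h3
  have h4 : Module.finrank (ZMod 2) (LinearMap.range σ) = 1 := by
    have : LinearMap.range σ = ⊤ := by
      rw [LinearMap.range_eq_top]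
      intro a
      obtain ⟨p⟩ := ‹Nonempty C›
      exact ⟨Pi.single p a, by rw [hσ, Finset.sum_pi_single']; simp⟩
    rw [this, finrank_top, Module.finrank_self]
  -- Boundaries have even total, which bounds their dimension by C - 1.
  have h5 : Module.finrank (ZMod 2) (LinearMap.range D.boundary) ≤
      Module.finrank (ZMod 2) (LinearMap.ker σ) := by
    apply Submodule.finrank_mono
    rintro _ ⟨w, rfl⟩
    rw [LinearMap.mem_ker, hσ, D.sum_boundary]
  -- Functions on edges are pulled back to edge ends, where coboundaries live; nothing is lost,
  -- since every edge has an end.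
  let ψ : (P → ZMod 2) →ₗ[ZMod 2] (C × ZMod 4 → ZMod 2) :=
    LinearMap.funLeft (ZMod 2) (ZMod 2) fun x => D.edge x.1 x.2
  have hψ : Function.Injective ψ := LinearMap.funLeft_injective_of_surjective _ _ _ fun z => by
    obtain ⟨p, k, h⟩ := D.exists_edge_eq z
    exact ⟨(p, k), h⟩
  have h6 : Module.finrank (ZMod 2) (LinearMap.ker D.boundary) ≤
      Module.finrank (ZMod 2) (LinearMap.range D.coboundary) := by
    rw [(Submodule.equivMapOfInjective ψ hψ _).finrank_eq]
    apply Submodule.finrank_mono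
    rintro _ ⟨w, hw, rfl⟩
    obtain ⟨c, hc⟩ := D.exists_coloring' (LinearMap.mem_ker.1 hw)
    refine ⟨c, funext fun x => ?_⟩
    change c _ - c _ = w _
    rw [hc, add_sub_cancel_left]
  -- Constant colourings have no differences.
  have h7 : 1 ≤ Module.finrank (ZMod 2) (LinearMap.ker D.coboundary) := by
    obtain ⟨p⟩ := ‹Nonempty C›
    have hmem : (fun _ => 1 : F → ZMod 2) ∈ LinearMap.ker D.coboundary := by
      rw [LinearMap.mem_ker]
      ext x
      exact sub_self _
    have : Nontrivial (LinearMap.ker D.coboundary) :=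
      ⟨⟨_, hmem⟩, 0, fun h => one_ne_zero (congrFun (congrArg Subtype.val h) (D.corner p 0))⟩
    exact Module.finrank_pos
  have h8 := D.card_marks
  omega

/-- The cycle is the part of the curve between visits to `p` that ends with the edge arriving at
`D.fst p`. Away from `p` it contains an incoming edge exactly when it contains the edge that
continues it; at `p` the boundary vanishes because its total over all crossings is zero. -/
theorem exists_separating (p : C) : ∃ w : P → ZMod 2, D.boundary w = 0 ∧
    w (D.fst p) = 1 ∧ w (D.snd p) = 0 := by
  classical
  obtain ⟨T, hs, ht, hT⟩ := exists_segment D.next (D.fst_ne_snd p)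
  refine ⟨T.indicator 1, ?_, by simp [hs], by simp [ht]⟩
  have key : ∀ q, q ≠ p → D.boundary (T.indicator 1) q = 0 := by
    intro q hq
    change ∑ k, T.indicator 1 (D.edge q k) = 0
    have h : ∀ z, D.base z = q →
        T.indicator (1 : P → ZMod 2) z + T.indicator 1 (D.next z) = 0 := by
      rintro z rfl
      have hz : ¬ (z = D.fst p ∨ z = D.snd p) := fun h => hq ((D.base_eq_iff z p).2 h)
      rw [not_or] at hz
      have := hT z hz.1 hz.2
      simp only [Set.indicator_apply, this]
      exact CharTwo.add_self_eq_zero _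
    rw [D.sum_edge_eq, h _ ((D.base_eq_iff _ _).2 (.inl rfl)),
      h _ ((D.base_eq_iff _ _).2 (.inr rfl)), add_zero]
  ext q
  by_cases hq : q = p
  · subst hq
    have := D.sum_boundary (T.indicator 1)
    rwa [Finset.sum_eq_single q (fun q' _ h => key q' h) (by simp)] at this
  · exact key q hq

/-- Adjacent corners differ by the checkerboard colouring. If both opposite pairs coincided, every
colouring would change equally across all four edges, contrary to `exists_separating`. If exactly
one pair coincided, there would be exactly three regions, contrary to irreducibility. -/
theorem corner_injective (p : C) : Function.Injective (D.corner p) := by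
  have hadj := D.corner_succ_ne p
  have h02 : ¬ (D.corner p 0 = D.corner p 2 ∧ D.corner p 1 = D.corner p 3) := by
    rintro ⟨h0, h1⟩
    obtain ⟨w, hw, hw1, hw0⟩ := D.exists_separating p
    obtain ⟨c, hc⟩ := D.exists_coloring' hw
    have e0 : c (D.corner p 1) = _ := hc p 0
    have e1 : c (D.corner p 2) = _ := hc p 1
    have e2 : c (D.corner p 3) = _ := hc p 2
    have e3 : c (D.corner p 0) = _ := hc p 3
    have hall : w (D.edge p 0) = w (D.edge p 1) ∧ w (D.edge p 1) = w (D.edge p 2) ∧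
        w (D.edge p 2) = w (D.edge p 3) := by
      rw [← h0] at e1 e2
      rw [← h1] at e2 e3
      generalize c (D.corner p 0) = a at *
      generalize c (D.corner p 1) = b at *
      generalize w (D.edge p 0) = w0 at *
      generalize w (D.edge p 1) = w1 at *
      generalize w (D.edge p 2) = w2 at *
      generalize w (D.edge p 3) = w3 at *
      clear hw hw1 hw0 hc h0 h1 hadj
      revert a b w0 w1 w2 w3
      decide
    have hne : w (D.fst p) ≠ w (D.snd p) := by rw [hw1, hw0]; exact one_ne_zero
    rcases D.edge_fst p with ⟨a, a'⟩ | ⟨a, a'⟩ <;> rcases D.edge_snd p with ⟨b, b'⟩ | ⟨b, b'⟩ <;>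
      rw [a, a', b, b'] at hall <;> apply hne
    · exact hall.1
    · exact hall.1.trans (hall.2.1.trans hall.2.2)
    · exact hall.2.1.symm
    · exact hall.2.2
  have h3 := D.card_corner_ne p
  have hr : Set.range (D.corner p) =
      {D.corner p 0, D.corner p 1, D.corner p 2, D.corner p 3} := by
    ext R
    constructor
    · rintro ⟨k, rfl⟩
      fin_cases k
      exacts [.inl rfl, .inr (.inl rfl), .inr (.inr (.inl rfl)), .inr (.inr (.inr rfl))]
    · rintro (rfl | rfl | rfl | rfl) <;> exact mem_range_self _
  rw [hr] at h3
  have a01 : D.corner p 1 ≠ D.corner p 0 := hadj 0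
  have a12 : D.corner p 2 ≠ D.corner p 1 := hadj 1
  have a23 : D.corner p 3 ≠ D.corner p 2 := hadj 2
  have a30 : D.corner p 0 ≠ D.corner p 3 := hadj 3
  have n02 : D.corner p 0 ≠ D.corner p 2 := by
    intro h
    have h' := fun h1 => h02 ⟨h, h1⟩
    apply h3
    rw [← h, Set.insert_eq_of_mem (by simp)]
    exact Set.encard_eq_three.2 ⟨_, _, _, h', a01, a30.symm, by ext; simp; tauto⟩
  have n13 : D.corner p 1 ≠ D.corner p 3 := by
    intro h
    apply h3
    rw [← h]
    exact Set.encard_eq_three.2 ⟨_, _, _, a01, a12.symm, n02, by ext; simp; tauto⟩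
  intro k l hkl
  fin_cases k <;> fin_cases l <;> first | rfl | exact absurd hkl ‹_› | exact absurd hkl.symm ‹_›

/-- Count edge ends along `R`: each crossing on its boundary has one corner in `R`, which is
bordered by two edge ends, and each edge has two ends. -/
theorem card_edges (R : F) : (D.edges R).card = (D.corners R).card := by
  classical
  have h := D.sum_edge fun z => if R ∈ D.sides z then 1 else 0
  rw [← Finset.card_filter] at h
  have h2 : ∀ p, ∑ k, (if R ∈ D.sides (D.edge p k) then 1 else 0) =
      2 * if p ∈ D.corners R then 1 else 0 := by
    intro p
    have hk : ∀ k, (if R ∈ D.sides (D.edge p k) then 1 else 0) =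
        (if D.corner p k = R then 1 else 0) + if D.corner p (k + 1) = R then 1 else 0 := by
      intro k
      simp only [D.sides_edge, Finset.mem_insert, Finset.mem_singleton]
      by_cases h1 : D.corner p k = R
      · have h2 : D.corner p (k + 1) ≠ R := h1 ▸ D.corner_succ_ne p k
        simp [h1, h2]
      · by_cases h2 : D.corner p (k + 1) = R
        · simp [h1, h2]
        · simp [h1, h2, Ne.symm h1, Ne.symm h2]
    have hs : ∑ k, (if D.corner p (k + 1) = R then 1 else 0) =
        ∑ k, if D.corner p k = R then 1 else 0 :=
      Equiv.sum_comp (Equiv.addRight (1 : ZMod 4)) fun k => if D.corner p k = R then 1 else 0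
    rw [Finset.sum_congr rfl fun k _ => hk k, Finset.sum_add_distrib, hs, ← two_mul]
    congr 1
    split_ifs with hp
    · obtain ⟨k, rfl⟩ := mem_corners.1 hp
      simp [(D.corner_injective p).eq_iff]
    · rw [mem_corners, not_exists] at hp
      simp [hp]
  rw [Finset.sum_congr rfl fun p _ => h2 p, ← Finset.mul_sum, ← Finset.card_filter] at h
  have h3 : univ.filter (fun p => p ∈ D.corners R) = D.corners R := by simp
  rw [h3, smul_eq_mul] at h
  exact (Nat.eq_of_mul_eq_mul_left two_pos h).symm

/-- With a single crossing there would be a single edge by `card_edges`, so the two edges bordering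
the corner would agree; comparing their sides identifies two different corners. -/
theorem two_le_card_corners (R : F) : 2 ≤ (D.corners R).card := by
  obtain ⟨p, k, rfl⟩ := D.exists_corner R
  by_contra! hlt
  have h1 : D.edge p k ∈ D.edges (D.corner p k) := by
    rw [mem_edges, D.sides_edge]
    simp
  have h2 : D.edge p (k - 1) ∈ D.edges (D.corner p k) := by
    rw [mem_edges, D.sides_edge, sub_add_cancel]
    simp
  have h3 := Finset.card_le_one.1 ((D.card_edges _).le.trans (Nat.lt_succ_iff.1 hlt)) _ h1 _ h2
  have h4 : D.corner p (k + 1) ∈ D.sides (D.edge p k) := by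
    rw [D.sides_edge]
    simp
  rw [h3, D.sides_edge, sub_add_cancel, Finset.mem_insert, Finset.mem_singleton] at h4
  rcases h4 with h4 | h4
  · exact (by decide : ∀ k : ZMod 4, k + 1 ≠ k - 1) k (D.corner_injective p h4)
  · exact D.corner_succ_ne p k h4

variable [Fintype F]

theorem sum_card_corners : ∑ R, (D.corners R).card = 4 * Fintype.card C := by
  have h := Finset.sum_card_bipartiteAbove_eq_sum_card_bipartiteBelow
    (s := (univ : Finset F)) (t := (univ : Finset C)) fun R p => ∃ k, D.corner p k = R
  change ∑ R, (D.corners R).card = _ at h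
  rw [h]
  have : ∀ p, (univ.bipartiteBelow (fun R p => ∃ k, D.corner p k = R) p).card = 4 := by
    intro p
    have : univ.bipartiteBelow (fun R p => ∃ k, D.corner p k = R) p =
        Finset.univ.image (D.corner p) := by
      ext R
      simp [Finset.bipartiteBelow]
    rw [this, Finset.card_image_of_injective _ (D.corner_injective p), Finset.card_univ, ZMod.card]
  simp [this, mul_comm]

/-- A neighbour is `R` itself, or opposite to `R` at a crossing (`A`), or across an edge of `R`
(`B`). There are as many edges as crossings. -/
theorem card_neighbors_le (R : F) : (D.neighbors R).card ≤ 1 + 2 * (D.corners R).card := by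
  let A := (D.corners R).biUnion fun p =>
    univ.filter fun R' => ∃ k, D.corner p k = R ∧ D.corner p (k + 2) = R'
  let B := (D.edges R).biUnion fun z => D.sides z \ {R}
  have hA : A.card ≤ (D.corners R).card * 1 := by
    refine Finset.card_biUnion_le_card_mul _ _ _ fun p _ => Finset.card_le_one.2 ?_
    intro a ha b hb
    obtain ⟨k, hk, rfl⟩ := (Finset.mem_filter.1 ha).2
    obtain ⟨l, hl, rfl⟩ := (Finset.mem_filter.1 hb).2
    rw [D.corner_injective p (hk.trans hl.symm)]
  have hB : B.card ≤ (D.edges R).card * 1 := by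
    refine Finset.card_biUnion_le_card_mul _ _ _ fun z hz => ?_
    rw [mem_edges] at hz
    rw [Finset.card_sdiff_of_subset (by simpa using hz), Finset.card_singleton]
    obtain ⟨p, k, rfl⟩ := D.exists_edge_eq z
    rw [D.sides_edge]
    have := Finset.card_le_two (a := D.corner p k) (b := D.corner p (k + 1))
    omega
  have hsub : D.neighbors R ⊆ {R} ∪ (A ∪ B) := by
    intro R' hR'
    obtain ⟨p, k, l, hk, hl⟩ := mem_neighbors.1 hR'
    have hp : p ∈ D.corners R := mem_corners.2 ⟨k, hk⟩
    have hside : ∀ j, R ∈ D.sides (D.edge p j) → R' ∈ D.sides (D.edge p j) →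
        R' ∈ {R} ∪ (A ∪ B) := by
      intro j h1 h2
      by_cases h : R' = R
      · simp [h]
      · refine Finset.mem_union_right _ (Finset.mem_union_right _ (Finset.mem_biUnion.2
          ⟨_, mem_edges.2 h1, ?_⟩))
        simp [h, h2]
    rcases (by decide : ∀ k l : ZMod 4, l = k ∨ l = k + 1 ∨ l = k + 2 ∨ k = l + 1) k l with
      rfl | rfl | rfl | rfl
    · simp [← hk, ← hl]
    · exact hside k (by simp [D.sides_edge, hk]) (by simp [D.sides_edge, hl])
    · refine Finset.mem_union_right _ (Finset.mem_union_left _ (Finset.mem_biUnion.2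
        ⟨p, hp, Finset.mem_filter.2 ⟨mem_univ _, k, hk, hl⟩⟩))
    · exact hside l (by simp [D.sides_edge, hk]) (by simp [D.sides_edge, hl])
  have h1 := Finset.card_le_card hsub
  have h2 := Finset.card_union_le {R} (A ∪ B)
  have h3 := Finset.card_union_le A B
  have h4 := D.card_edges R
  simp only [Finset.card_singleton] at h2
  omega

/-- Two regions of small degree that share no crossing leave room for a third one. -/
theorem exists_third {R₁ R₂ : F} (h12 : R₂ ∉ D.neighbors R₁)
    (h : 2 + 2 * (D.corners R₁).card + 2 * (D.corners R₂).card < Fintype.card F) :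
    ∃ R₁ R₂ R₃, R₂ ∉ D.neighbors R₁ ∧ R₃ ∉ D.neighbors R₁ ∧ R₃ ∉ D.neighbors R₂ := by
  by_contra! hno
  have hsub : (univ : Finset F) ⊆ D.neighbors R₁ ∪ D.neighbors R₂ := by
    intro R₃ _
    by_cases h3 : R₃ ∈ D.neighbors R₁
    · exact Finset.mem_union_left _ h3
    · exact Finset.mem_union_right _ (hno R₁ R₂ R₃ h12 h3)
  have h1 := Finset.card_le_card hsub
  have h2 := Finset.card_union_le (D.neighbors R₁) (D.neighbors R₂)
  have h3 := D.card_neighbors_le R₁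
  have h4 := D.card_neighbors_le R₂
  rw [Finset.card_univ] at h1
  omega

/-- Only the neighbours of `R` may fall short of degree `a + b`, and each by at most `b`. -/
theorem sum_card_corners_ge {a b : ℕ} (R : F) (ha : ∀ R', a ≤ (D.corners R').card)
    (hb : ∀ R' ∉ D.neighbors R, a + b ≤ (D.corners R').card) :
    (a + b) * Fintype.card F ≤ 4 * Fintype.card C + b * (D.neighbors R).card := by
  have h : ∀ R', a + b ≤ (D.corners R').card + if R' ∈ D.neighbors R then b else 0 := by
    intro R'
    split_ifs with h
    · exact Nat.add_le_add_right (ha R') b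
    · exact hb R' h
  have h1 := Finset.sum_le_sum fun R' (_ : R' ∈ Finset.univ) => h R'
  rw [Finset.sum_add_distrib (f := fun R' => (D.corners R').card), D.sum_card_corners,
    Finset.sum_ite_mem, Finset.univ_inter] at h1
  simp only [Finset.sum_const, smul_eq_mul, Finset.card_univ] at h1
  linarith [mul_comm b (D.neighbors R).card, mul_comm (a + b) (Fintype.card F)]

/-- A diagram with at least 13 crossings has three regions that pairwise share no crossing. -/
theorem exists_three (hC : 13 ≤ Fintype.card C) :
    ∃ R₁ R₂ R₃, R₂ ∉ D.neighbors R₁ ∧ R₃ ∉ D.neighbors R₁ ∧ R₃ ∉ D.neighbors R₂ := by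
  have : Nonempty C := Fintype.card_pos_iff.1 (by omega)
  have hF := D.card_add_two_le
  by_contra hno
  by_cases h2 : ∃ R, (D.corners R).card = 2
  · obtain ⟨R, hR⟩ := h2
    -- A non-neighbour of degree at most 4 would give 2 + 4 + 8 = 14 < 15 in `exists_third`. With at
    -- most 5 neighbours, 5(C + 2) ≤ 4C + 15, which is false.
    have h5 := D.sum_card_corners_ge (a := 2) (b := 3) R D.two_le_card_corners fun R' hR' => by
      by_contra! hlt
      exact hno (D.exists_third hR' (by omega))
    have := D.card_neighbors_le R
    omega
  · have h3 : ∀ R, 3 ≤ (D.corners R).card := fun R =>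
      lt_of_le_of_ne (D.two_le_card_corners R) fun h => h2 ⟨R, h.symm⟩
    obtain ⟨R, hR⟩ : ∃ R, (D.corners R).card ≤ 3 := by
      by_contra! h
      have h4 := Finset.sum_le_sum fun R (_ : R ∈ Finset.univ) => Nat.succ_le_of_lt (h R)
      rw [D.sum_card_corners] at h4
      simp only [Finset.sum_const, smul_eq_mul, Finset.card_univ] at h4
      omega
    -- A non-neighbour of degree 3 would again give 2 + 6 + 6 = 14 < 15. With at most 7 neighbours,
    -- 4(C + 2) ≤ 4C + 7, which is false.
    have h5 := D.sum_card_corners_ge (a := 3) (b := 1) R h3 fun R' hR' => by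
      by_contra! hlt
      exact hno (D.exists_third hR' (by have := h3 R'; omega))
    have := D.card_neighbors_le R
    omega

end Diagram

end Combinatorics

/-! ### The diagram of a link projection -/

theorem eq_of_isPreconnected {S α : Type*} [TopologicalSpace S] {A : Set S} (hA : IsPreconnected A)
    {c : S → α} (hc : ∀ x ∈ A, ∀ᶠ y in 𝓝 x, c y = c x) {x y : S} (hx : x ∈ A) (hy : y ∈ A) :
    c x = c y := by
  refine hA.induction₂' (fun x y => c x = c y) (fun x hx => ?_)
    (fun _ _ _ _ _ _ h1 h2 => h1.trans h2) hx hy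
  filter_upwards [nhdsWithin_le_nhds (hc x hx)] with y hy
  exact ⟨hy.symm, hy⟩

namespace LinkProjection

variable {L : LinkProjection}

theorem injOn_curve {x y : Fin L.components × Circle} (hx : x ∉ L.marks)
    (h : L.curve x = L.curve y) : x = y := by
  by_contra hne
  exact hx ⟨x, y, hne, rfl, h.symm⟩

theorem eventually_nextMark_fiber (hM : IsMarking L.marks) {x : Fin L.components × Circle}
    (hx : x ∉ L.marks) : ∀ᶠ q in 𝓝 (L.curve x), ∀ y, L.curve y = q →
      y ∉ L.marks ∧ nextMark L.marks y = nextMark L.marks x := by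
  refine eventually_fiber fun y hy => ?_
  rw [← injOn_curve hx hy.symm]
  exact hM.eventually_nextMark_eq hx

/-- Jumps along the edges that add up to zero at each crossing are the jumps of a locally constant
function on the complement. -/
theorem exists_coloring (hM : IsMarking L.marks) (w : Fin L.components × Circle → ZMod 2)
    (hw : ∀ p ∈ L.crossings, ∃ U Q V, IsCrossBox L.image U p Q V ∧
      ∃ ε : ZMod 4 → Fin L.components × Circle,
        (∀ k x, L.curve x ∈ V k → nextMark L.marks x = ε k) ∧ ∑ k, w (ε k) = 0) :
    ∃ c : S2 → ZMod 2, (∀ x, x ∉ L.image → ∀ᶠ y in 𝓝 x, c y = c x) ∧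
      ∀ x ∉ L.marks, ∀ U A B, IsFlatBox L.image U A B → L.curve x ∈ U → ∀ a ∈ A, ∀ b ∈ B,
        c b = c a + w (nextMark L.marks x) := by
  let j : S2 → ZMod 2 := Function.extend (fun x : {x // x ∉ L.marks} => L.curve x)
    (fun x => w (nextMark L.marks x)) 0
  have hj : ∀ x ∉ L.marks, j (L.curve x) = w (nextMark L.marks x) := by
    intro x hx
    have hinj : Function.Injective fun x : {x // x ∉ L.marks} => L.curve x := fun x y h =>
      Subtype.ext (injOn_curve x.2 h)
    exact hinj.extend_apply _ _ ⟨x, hx⟩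
  have hbal : IsBalanced L.image L.crossings j := by
    refine ⟨L.crossings_subset, L.dense_compl_image, L.isClosed_image.isOpen_compl, ?_, ?_⟩
    · rintro _ ⟨⟨x, rfl⟩, hx⟩
      refine ⟨isFlatPoint (mem_range_self x) hx, ?_⟩
      filter_upwards [eventually_nextMark_fiber hM (x := x) hx] with q hq
      rintro ⟨y, rfl⟩
      obtain ⟨h1, h2⟩ := hq y rfl
      exact ⟨h1, by rw [hj y h1, hj x hx, h2]⟩
    · intro p hp
      obtain ⟨U, Q, V, hbox, ε, hε, hsum⟩ := hw p hp
      refine ⟨U, Q, V, hbox, fun k => w (ε k), hsum, ?_⟩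
      rintro k _ ⟨hxV, x, rfl⟩
      have hx := hbox.arm_notMem_crossings hxV
      exact ⟨hx, by rw [hj x hx, hε k x hxV]⟩
  let x₀ : Fin L.components × Circle := (⟨0, L.components_pos⟩, 1)
  obtain ⟨c, hc, hjump⟩ := hbal.exists_coloring_sphere (v := L.curve x₀) (mem_range_self x₀)
  refine ⟨c, hc, fun x hx U A B hbox hxU a ha b hb => ?_⟩
  -- At the pole `L.curve x₀` no jump is known, so `x` is moved slightly along its edge; the box,
  -- and hence the two colours, stay the same.
  obtain ⟨y, hy, hyU, hyN, hyx⟩ : ∃ y, y ∉ L.marks ∧ L.curve y ∈ U ∧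
      nextMark L.marks y = nextMark L.marks x ∧ y ≠ x₀ := by
    by_cases hxx : x = x₀
    · have h1 := hM.eventually_nextMark_eq hx
      have h2 := L.continuous_curve.continuousAt.eventually (hbox.isOpen.mem_nhds hxU)
      have hM' : IsMarking (insert x L.marks) := ⟨hM.finite.insert x, fun i => by
        obtain ⟨z, hz, hzi⟩ := hM.meets i
        exact ⟨z, .inr hz, hzi⟩⟩
      obtain ⟨ε, hε, h3⟩ := hM'.exists_rot_notMem x
      have h4 := (tendsto_rot x).eventually (h1.and h2)
      have h5 : ∀ᶠ θ in 𝓝 (0 : ℝ), |θ| < ε :=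
        (continuous_abs.tendsto' 0 0 abs_zero).eventually (gt_mem_nhds hε)
      have h6 := (h4.and h5).filter_mono (nhdsWithin_le_nhds (s := {0}ᶜ))
      obtain ⟨θ, ⟨⟨⟨h7, h8⟩, h9⟩, h10⟩, h11⟩ := (h6.and self_mem_nhdsWithin).exists
      exact ⟨_, h7, h9, h8, fun h => h3 θ h11 h10 (.inl (h.trans hxx.symm))⟩
    · exact ⟨x, hx, hxU, rfl, hxx⟩
  have hy' := hjump (L.curve y) ⟨mem_range_self y, hy⟩ fun h => hyx (injOn_curve hy h)
  rw [hj y hy, hyN] at hy'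
  refine hy'.eq_add (mem_range_self y) (isFlatPoint (mem_range_self y) hy) hbox hyU ?_ ?_
  · exact fun z hz => eq_of_isPreconnected hbox.isPreconnected_left
      (fun z hz => hc z (hbox.left_subset hz).2) hz ha
  · exact fun z hz => eq_of_isPreconnected hbox.isPreconnected_right
      (fun z hz => hc z (hbox.right_subset hz).2) hz hb

/-- Both points lie in one flat box. With `IsMarking.eq_of_nextMark_eq` this makes the adjacent
regions depend only on the edge. -/
theorem eventually_sides_eq {x : Fin L.components × Circle} (hx : x ∉ L.marks) :
    ∀ᶠ y in 𝓝 x, L.sides (L.curve y) = L.sides (L.curve x) := by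
  obtain ⟨U, A, B, hxU, -, hbox⟩ := isFlatPoint (mem_range_self x) hx univ univ_mem
  have hxL : L.curve x ∈ U ∩ L.image := ⟨hxU, mem_range_self x⟩
  obtain ⟨a, ha⟩ := hbox.left_nonempty hxL
  obtain ⟨b, hb⟩ := hbox.right_nonempty hxL
  filter_upwards [L.continuous_curve.continuousAt.eventually (hbox.isOpen.mem_nhds hxU)] with y hy
  rw [hbox.sides_eq hxL ha hb, hbox.sides_eq ⟨hy, mem_range_self y⟩ ha hb]

theorem exists_mem_frontier {R : Set S2} (hR : R ∈ L.regions) : ∃ q, q ∈ frontier R := by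
  by_contra! h
  have hclopen : IsClopen R := isClopen_iff_frontier_eq_empty.2 (eq_empty_of_forall_notMem h)
  have huniv := hclopen.eq_univ (region_nonempty hR)
  have x : Fin L.components × Circle := (⟨0, L.components_pos⟩, 1)
  exact subset_compl_image hR (huniv ▸ mem_univ (L.curve x)) (mem_range_self x)

open scoped Classical in
/-- The combinatorial data of a connected irreducible link projection. -/
theorem exists_diagram (hconn : L.Connected) (hirr : L.Irreducible)
    (hne : L.crossings.Nonempty) :
    ∃ D : Diagram L.crossings L.marks L.regions,
      ∀ p R, p.1 ∈ frontier R.1 ↔ ∃ k, D.corner p k = R := by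
  have hM := isMarking_marks hconn hne
  choose s t U Q V ε hst hfib hbox hε hs ht using
    fun p : L.crossings => exists_crossBox_edges hM p.2
  have hQne : ∀ p k, (Q p k).Nonempty := fun p k =>
    closure_nonempty_iff.1 ⟨_, (hbox p).mem_closure k⟩
  choose x hx using hQne
  choose y hy using fun p k => (hbox p).arm_nonempty k
  have hxL : ∀ p k, x p k ∉ L.image := fun p k => ((hbox p).quadrant_subset k (hx p k)).2
  have hyx : ∀ p k, ∃ z, L.curve z = y p k := fun p k => (hy p k).2
  choose z hz using hyx
  have hzV : ∀ p k, L.curve (z p k) ∈ V p k := fun p k => hz p k ▸ (hy p k).1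
  have hzM : ∀ p k, z p k ∉ L.marks := fun p k => (hbox p).arm_notMem_crossings (hzV p k)
  have hzN : ∀ p k, nextMark L.marks (z p k) = ε p k := fun p k => hε p k _ (hzV p k)
  have hεM : ∀ p k, ε p k ∈ L.marks := fun p k => hzN p k ▸ hM.nextMark_mem _
  have hsides : ∀ p k x', x' ∉ L.marks → nextMark L.marks x' = ε p k →
      L.sides (L.curve x') = {L.regionOf (x p k), L.regionOf (x p (k + 1))} := by
    intro p k x' hx' hN
    rw [← ((hbox p).flat k).sides_eq ⟨hzV p k, mem_range_self _⟩ (hx p k) (hx p (k + 1))]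
    exact hM.eq_of_nextMark_eq (f := fun x => L.sides (L.curve x))
      (fun x hx => eventually_sides_eq hx) hx' (hzM p k) (hN.trans (hzN p k).symm)
  have hpsides : ∀ p : L.crossings, L.sides p = range fun k => L.regionOf (x p k) := fun p =>
    (hbox p).sides_eq (L.crossings_subset p.2) (hx p)
  have hsM : ∀ p, L.curve (s p) = p := fun p =>
    (hfib p ▸ mem_insert _ _ : s p ∈ L.curve ⁻¹' {p.1})
  have htM : ∀ p, L.curve (t p) = p := fun p =>
    (hfib p ▸ mem_insert_of_mem _ rfl : t p ∈ L.curve ⁻¹' {p.1})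
  have : Finite L.marks := hM.finite
  let corner : L.crossings → ZMod 4 → L.regions := fun p k =>
    ⟨L.regionOf (x p k), regionOf_mem_regions (hxL p k)⟩
  have hfr : ∀ (p : L.crossings) (R : L.regions), p.1 ∈ frontier R.1 ↔ ∃ k, corner p k = R := by
    intro p R
    have : R.1 ∈ L.sides p ↔ p.1 ∈ frontier R.1 := and_iff_right R.2
    rw [← this, hpsides]
    exact exists_congr fun k => ⟨fun h => Subtype.ext h, fun h => congrArg Subtype.val h⟩
  let next : Equiv.Perm L.marks := Equiv.ofBijective
    (fun z => ⟨nextMark L.marks z, hM.nextMark_mem z⟩)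
    (Finite.injective_iff_bijective.1 fun a b h =>
      Subtype.ext (hM.nextMark_injOn a.2 b.2 (congrArg Subtype.val h)))
  have hbase : ∀ (z : L.marks) (p : L.crossings), L.curve z = p ↔ z.1 = s p ∨ z.1 = t p := by
    intro z p
    have : z.1 ∈ L.curve ⁻¹' {p.1} ↔ z.1 ∈ ({s p, t p} : Set _) := by rw [hfib]
    exact this
  have hedge : ∀ z : L.marks, ∃ p k, ε p k = z := by
    intro z
    refine ⟨⟨L.curve z, z.2⟩, ?_⟩
    rcases (hbase z ⟨L.curve z, z.2⟩).1 rfl with h | h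
    · rcases hs ⟨L.curve z, z.2⟩ with ⟨h0, -⟩ | ⟨-, h0⟩ <;> exact ⟨_, h0.trans h.symm⟩
    · rcases ht ⟨L.curve z, z.2⟩ with ⟨h0, -⟩ | ⟨-, h0⟩ <;> exact ⟨_, h0.trans h.symm⟩
  have hcorner : ∀ R, ∃ p k, corner p k = R := by
    intro R
    -- A boundary point on an edge can be pushed along it to a crossing, as the sides are constant
    -- along the edge.
    obtain ⟨q, hq⟩ := exists_mem_frontier R.2
    obtain ⟨x', rfl⟩ := frontier_subset_image R.2 hq
    by_cases hx' : L.curve x' ∈ L.crossings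
    · exact ⟨⟨_, hx'⟩, (hfr ⟨_, hx'⟩ R).1 hq⟩
    · obtain ⟨p, k, hpk⟩ := hedge ⟨_, hM.nextMark_mem x'⟩
      have : R.1 ∈ L.sides (L.curve x') := ⟨R.2, hq⟩
      rw [hsides p k x' hx' hpk.symm] at this
      rcases this with h | h
      · exact ⟨p, k, Subtype.ext h.symm⟩
      · exact ⟨p, k + 1, Subtype.ext h.symm⟩
  -- The choice of an end of the edge does not matter, and the value `∅` never occurs because every
  -- mark is some `ε p k` by `hedge`.
  let sides : L.marks → Finset L.regions := fun m =>
    if h : ∃ pk : L.crossings × ZMod 4, ε pk.1 pk.2 = m then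
      {corner h.choose.1 h.choose.2, corner h.choose.1 (h.choose.2 + 1)} else ∅
  have hsides' : ∀ p k, sides ⟨ε p k, hεM p k⟩ = {corner p k, corner p (k + 1)} := by
    intro p k
    have h : ∃ pk : L.crossings × ZMod 4, ε pk.1 pk.2 = ε p k := ⟨(p, k), rfl⟩
    have h1 := hsides p k (z p k) (hzM p k) (hzN p k)
    rw [hsides _ _ (z p k) (hzM p k) ((hzN p k).trans h.choose_spec.symm)] at h1
    simp only [sides, dif_pos h]
    ext R
    have h2 := Set.ext_iff.1 h1 R.1
    simpa only [corner, Finset.mem_insert, Finset.mem_singleton, Subtype.ext_iff,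
      Set.mem_insert_iff, Set.mem_singleton_iff] using h2
  have hcol : ∀ w : L.marks → ZMod 2, (∀ p, ∑ k, w ⟨ε p k, hεM p k⟩ = 0) →
      ∃ c : L.regions → ZMod 2, ∀ p k, c (corner p (k + 1)) = c (corner p k) +
        w ⟨ε p k, hεM p k⟩ := by
    intro w hw
    let w' : Fin L.components × Circle → ZMod 2 := fun m => if h : m ∈ L.marks then w ⟨m, h⟩ else 0
    have hw' : ∀ p k, w' (ε p k) = w ⟨ε p k, hεM p k⟩ := fun p k => dif_pos (hεM p k)
    obtain ⟨c, hc, hjump⟩ := exists_coloring hM w' fun p hp => ⟨_, _, _, hbox ⟨p, hp⟩, _,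
      hε ⟨p, hp⟩, by simp only [hw']; exact hw ⟨p, hp⟩⟩
    -- The colouring is constant on each region, so it can be read off at one sample point.
    choose r hr using fun R : L.regions => region_nonempty R.2
    have hcr : ∀ p k, c (r (corner p k)) = c (x p k) := fun p k =>
      eq_of_isPreconnected (isPreconnected_region (corner p k).2)
        (fun v hv => hc v (subset_compl_image (corner p k).2 hv)) (hr _) (mem_regionOf (hxL p k))
    refine ⟨fun R => c (r R), fun p k => ?_⟩
    change c (r _) = c (r _) + _
    rw [hcr, hcr, ← hw', ← hzN]
    exact hjump (z p k) (hzM p k) _ _ _ ((hbox p).flat k) (hzV p k) _ (hx p k) _ (hx p (k + 1))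
  refine ⟨{
    corner := corner
    edge := fun p k => ⟨ε p k, hεM p k⟩
    sides := sides
    sides_edge := hsides'
    next := next
    base := fun m => ⟨L.curve m, m.2⟩
    fst := fun p => ⟨s p, show L.curve (s p) ∈ L.crossings from (hsM p).symm ▸ p.2⟩
    snd := fun p => ⟨t p, show L.curve (t p) ∈ L.crossings from (htM p).symm ▸ p.2⟩
    fst_ne_snd := fun p h => hst p (congrArg Subtype.val h)
    base_eq_iff := fun m p => Subtype.ext_iff.trans
      ((hbase m p).trans (or_congr ⟨fun h => Subtype.ext h, fun h => congrArg Subtype.val h⟩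
        ⟨fun h => Subtype.ext h, fun h => congrArg Subtype.val h⟩))
    edge_fst := fun p => by
      simp only [Subtype.ext_iff]
      exact hs p
    edge_snd := fun p => by
      simp only [Subtype.ext_iff]
      exact ht p
    exists_corner := hcorner
    exists_coloring := hcol
    card_corner_ne := fun p h3 => hirr ⟨p, p.2, ?_⟩ }, hfr⟩
  have h4 : L.sides p = Subtype.val '' range (corner p) := by
    rw [hpsides, ← range_comp]
    rfl
  change (L.sides p).encard = 3
  rw [h4, Subtype.val_injective.encard_image, h3]

end LinkProjection

end LinkProj

/-! ### The isolate-region number -/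

open LinkProj LinkProj.LinkProjection in
theorem mainTheorem4 (L : LinkProj.LinkProjection) (hconn : L.Connected) (hirr : L.Irreducible)
    (hcross : 13 ≤ L.crossings.encard) : 3 ≤ L.isolateRegionNumber := by
  classical
  have hne : L.crossings.Nonempty := by
    rw [← Set.encard_pos]
    exact lt_of_lt_of_le (by norm_num) hcross
  obtain ⟨D, hD⟩ := exists_diagram hconn hirr hne
  have hM := isMarking_marks hconn hne
  have := L.finite_crossings.fintype
  have := hM.finite.fintype
  have : Finite L.regions := Finite.of_surjective
    (fun pk : L.crossings × ZMod 4 => D.corner pk.1 pk.2) fun R => by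
      obtain ⟨p, k, h⟩ := D.exists_corner R
      exact ⟨(p, k), h⟩
  have := Fintype.ofFinite L.regions
  have hC : 13 ≤ Fintype.card L.crossings := by
    rw [← Set.coe_fintypeCard] at hcross
    exact_mod_cast hcross
  obtain ⟨R₁, R₂, R₃, h12, h13, h23⟩ := D.exists_three hC
  have hdis : ∀ {R R'}, R' ∉ D.neighbors R → R.1 ≠ R'.1 ∧ L.RegionsDisconnected R.1 R'.1 ∧
      L.RegionsDisconnected R'.1 R.1 := by
    intro R R' h
    have key : ∀ p : L.crossings, p.1 ∈ frontier R.1 → p.1 ∈ frontier R'.1 → False := by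
      intro p h1 h2
      obtain ⟨k, hk⟩ := (hD p R).1 h1
      obtain ⟨l, hl⟩ := (hD p R').1 h2
      exact h (Diagram.mem_neighbors.2 ⟨p, k, l, hk, hl⟩)
    refine ⟨fun he => h (Subtype.ext he ▸ D.self_mem_neighbors R), ?_, ?_⟩
    · rintro ⟨p, hp, h1, h2⟩
      exact key ⟨p, hp⟩ h1 h2
    · rintro ⟨p, hp, h1, h2⟩
      exact key ⟨p, hp⟩ h2 h1
  obtain ⟨n12, d12, d21⟩ := hdis h12
  obtain ⟨n13, d13, d31⟩ := hdis h13
  obtain ⟨n23, d23, d32⟩ := hdis h23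
  have hiso : L.IsIsolated {R₁.1, R₂.1, R₃.1} := by
    constructor
    · rintro R (rfl | rfl | rfl)
      exacts [R₁.2, R₂.2, R₃.2]
    · rintro R (rfl | rfl | rfl) R' (rfl | rfl | rfl) hne
      exacts [(hne rfl).elim, d12, d13, d21, (hne rfl).elim, d23, d31, d32, (hne rfl).elim]
  have h3 : ({R₁.1, R₂.1, R₃.1} : Set (Set S2)).encard = 3 :=
    Set.encard_eq_three.2 ⟨_, _, _, n12, n13, n23, rfl⟩
  rw [← h3]
  exact le_iSup (fun W : {W : Set (Set S2) // L.IsIsolated W} => W.1.encard) ⟨_, hiso⟩
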